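/- For integers $m_1\ge 3$ and $m_2\ge 0$ put $p=2m_1-1$ and $N=3^{m_1-1}+2m_2-1$, and let $a_{2t-1}=3^{t-1}-1$ and $a_{2t}=2\cdot 3^{t-1}-1$ for $t\ge 1$. Let $\mathcal K_{m_1,m_2}$ be the polygonal complex with vertex set $\mathbb Z_{2N}$ whose faces are the $p$-cycles $$F_j=(j+a_1,\;j+a_2,\;\dots,\;j+a_{p-2},\;j+a_{p-1}+m_2,\;j+a_p+2m_2),\qquad j\in\mathbb Z_{2N},$$ and whose edges are the sides of these cycles. Given such a complex, place a qubit on each edge and consider the stabilizer code whose stabilizer group is generated by the operators $A_v$ (the tensor product of $X$ over the edges incident to the vertex $v$) and $B_F$ (the tensor product of $Z$ over the sides of the face $F$). It is the homological quantum code of the complex. A stabilizer code with stabilizer group $S$ is an $[[n,k,d]]$ code if it has $n$ qubits, dimension $2^k$, and minimum distance $d$, the minimum weight of a Pauli operator that commutes with all elements of $S$ and is not a phase multiple of an element of $S$. For all $m_1\ge 3$ and $m_2\ge 0$: 1. $\mathcal K_{m_1,m_2}$ is a map, that is, a cell decomposition of a connected closed surface by a simple graph and polygonal faces. It has $2N=2(3^{m_1-1}+2m_2-1)$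 vertices, it is equivelar of type $[(2m_1-1)^{2m_1-1}]$ (all faces are $(2m_1-1)$-gons and each vertex lies on $2m_1-1$ of them), and it is self-dual. 2. Let $H_X$ and $H_Z$ be the vertex-edge and face-edge incidence matrices of $\mathcal K_{m_1,m_2}$ over $\mathbb Z_2$, and let $C_X=\ker H_X$ and $C_Z=\ker H_Z$. Then $H_XH_Z^{T}=0$, and the homological quantum code of $\mathcal K_{m_1,m_2}$ has parameters $[[n,k,d]]$ with $$n=(2m_1-1)(3^{m_1-1}+2m_2-1),\qquad k=2+(2m_1-5)(3^{m_1-1}+2m_2-1),\qquad d=4.$$ Moreover $k=\dim H_1(\mathcal K_{m_1,m_2};\mathbb Z_2)$, and $d$ is the minimum weight of a word of $(C_X\setminus C_Z^{\perp})\cup(C_Z\setminus C_X^{\perp})$. Furthermore, the encoding rate $k/n$ of these codes tends to $1$ as $m_1,m_2\to\infty$. -/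

import Mathlib

open Filter Topology Matrix

/-! ### Maps on closed surfaces, given by their vertices, edges and faces -/

/-- Incidence data of a finite 2-dimensional cell complex with vertex set `V`, edge set `E` and
face set `F`: `endOf v e` means that `v` is an end of `e`, and `sideOf e f` means that `e` is a
side of the polygon `f`. -/
structure CellComplex (V E F : Type) where
  endOf : V → E → Prop
  sideOf : E → F → Prop

namespace CellComplex

variable {V E F : Type}

/-- The vertex `v` lies on the face `f`. -/
def onFace (K : CellComplex V E F) (v : V) (f : F) : Prop :=
  ∃ e, K.endOf v e ∧ K.sideOf e f

/-- The dual complex: the roles of vertices and faces are exchanged. -/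
def dual (K : CellComplex V E F) : CellComplex F E V where
  endOf f e := K.sideOf e f
  sideOf e v := K.endOf v e

/-- `K` is a map on a surface: a cell decomposition, by a simple graph and polygonal faces, of a
connected closed surface.

By `edge_ends`, `corner`, `side_exists` and `face_connected` the boundary of each face is one
cycle; by `edge_faces`, `corner`, `edge_exists` and `link_connected` the faces and edges at each
vertex alternate in one cycle, so that gluing a disc along the boundary cycle of every face gives a
closed surface. -/
structure IsMap (K : CellComplex V E F) : Prop where
  nonempty : Nonempty V
  /-- every edge has exactly two ends -/
  edge_ends : ∀ e, {v | K.endOf v e}.ncard = 2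
  /-- there are no multiple edges -/
  simple : ∀ e e', (∀ v, K.endOf v e ↔ K.endOf v e') → e = e'
  /-- every edge is a side of exactly two faces -/
  edge_faces : ∀ e, {f | K.sideOf e f}.ncard = 2
  /-- at a corner of a face exactly two sides of that face meet -/
  corner : ∀ v f, K.onFace v f → {e | K.endOf v e ∧ K.sideOf e f}.ncard = 2
  side_exists : ∀ f, ∃ e, K.sideOf e f
  edge_exists : ∀ v, ∃ e, K.endOf v e
  /-- one passes between any two sides of a face through sides of it with a common end -/
  face_connected : ∀ f e e', K.sideOf e f → K.sideOf e' f →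
    Relation.ReflTransGen
      (fun a b => K.sideOf a f ∧ K.sideOf b f ∧ ∃ v, K.endOf v a ∧ K.endOf v b) e e'
  /-- one passes between any two edges at a vertex through edges at it on a common face -/
  link_connected : ∀ v e e', K.endOf v e → K.endOf v e' →
    Relation.ReflTransGen
      (fun a b => K.endOf v a ∧ K.endOf v b ∧ ∃ f, K.sideOf a f ∧ K.sideOf b f) e e'
  connected : ∀ v w, Relation.ReflTransGen (fun a b => ∃ e, K.endOf a e ∧ K.endOf b e) v w

/-- `K` is equivelar of type `[p ^ q]`: all faces are `p`-gons, and each vertex is on `q` faces. -/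
def IsEquivelar (K : CellComplex V E F) (p q : ℕ) : Prop :=
  (∀ f, {e | K.sideOf e f}.ncard = p) ∧ ∀ v, {f | K.onFace v f}.ncard = q

/-- Two complexes are isomorphic: there are bijections of the cells that respect incidence. -/
def IsIso {V' E' F' : Type} (K : CellComplex V E F) (L : CellComplex V' E' F') : Prop :=
  ∃ (α : V ≃ V') (β : E ≃ E') (γ : F ≃ F'),
    (∀ v e, K.endOf v e ↔ L.endOf (α v) (β e)) ∧
    (∀ e f, K.sideOf e f ↔ L.sideOf (β e) (γ f))

/-- `K` is isomorphic to its dual. -/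
def IsSelfDual (K : CellComplex V E F) : Prop :=
  K.IsIso K.dual

end CellComplex

/-! ### Pauli operators and stabilizer codes -/

noncomputable section

/-- The matrices `I`, `X`, `Y`, `Z`. -/
def pauliI : Matrix (Fin 2) (Fin 2) ℂ := !![1, 0; 0, 1]
def pauliX : Matrix (Fin 2) (Fin 2) ℂ := !![0, 1; 1, 0]
def pauliY : Matrix (Fin 2) (Fin 2) ℂ := !![0, -Complex.I; Complex.I, 0]
def pauliZ : Matrix (Fin 2) (Fin 2) ℂ := !![1, 0; 0, -1]

def pauliMatrices : Set (Matrix (Fin 2) (Fin 2) ℂ) := {pauliI, pauliX, pauliY, pauliZ}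

/-- The phases `±1`, `±i`. -/
def pauliPhases : Set ℂ := {1, -1, Complex.I, -Complex.I}

section Stabilizer

variable {E : Type} [Fintype E] [DecidableEq E]

/-- The tensor product of the one-qubit operators `A e`, `e ∈ E`, as a matrix in the standard
basis `|j⟩`, `j : E → Fin 2`, of the state space of the qubits indexed by `E`. -/
def tensorOp (A : E → Matrix (Fin 2) (Fin 2) ℂ) : Matrix (E → Fin 2) (E → Fin 2) ℂ :=
  Matrix.of fun i j => ∏ e, A e (i e) (j e)

/-- The underlying set of the Pauli group on the qubits indexed by `E`. -/
def pauliGroup (E : Type) [Fintype E] : Set (Matrix (E → Fin 2) (E → Fin 2) ℂ) :=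
  {M | ∃ c ∈ pauliPhases, ∃ A : E → Matrix (Fin 2) (Fin 2) ℂ,
    (∀ e, A e ∈ pauliMatrices) ∧ M = c • tensorOp A}

/-- A stabilizer group: a subgroup of the Pauli group without `-I`. (The Pauli group is finite, so
a submonoid that lies in it is a subgroup.) -/
def IsStabilizerGroup (S : Submonoid (Matrix (E → Fin 2) (E → Fin 2) ℂ)) : Prop :=
  (∀ M ∈ S, M ∈ pauliGroup E) ∧ -1 ∉ S

/-- The stabilizer code of `S`: the states fixed by all elements of `S`. -/
def stabilizerCode (S : Submonoid (Matrix (E → Fin 2) (E → Fin 2) ℂ)) :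
    Submodule ℂ ((E → Fin 2) → ℂ) where
  carrier := {ψ | ∀ M ∈ S, M *ᵥ ψ = ψ}
  add_mem' := fun hx hy M hM => by rw [Matrix.mulVec_add, hx M hM, hy M hM]
  zero_mem' := fun M _ => Matrix.mulVec_zero M
  smul_mem' := fun c x hx M hM => by rw [Matrix.mulVec_smul, hx M hM]

/-- The weights of the Pauli operators that commute with every element of `S` and do not belong to
`S`, not even after multiplication by a phase. The weight is the number of qubits on which the
operator is not the identity. -/
def logicalWeights (S : Submonoid (Matrix (E → Fin 2) (E → Fin 2) ℂ)) : Set ℕ :=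
  {w | ∃ A : E → Matrix (Fin 2) (Fin 2) ℂ, (∀ e, A e ∈ pauliMatrices) ∧
    (∀ g ∈ S, tensorOp A * g * (tensorOp A)ᴴ = g) ∧
    (∀ c ∈ pauliPhases, c • tensorOp A ∉ S) ∧
    w = {e | A e ≠ pauliI}.ncard}

/-- The stabilizer code of `S` is an `[[n, k, d]]` quantum code: `S` is a stabilizer group on `n`
qubits, the code has dimension `2 ^ k`, and its minimum distance is `d`. -/
def IsQuantumCode (S : Submonoid (Matrix (E → Fin 2) (E → Fin 2) ℂ)) (n k d : ℕ) : Prop :=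
  IsStabilizerGroup S ∧ Nat.card E = n ∧ Module.finrank ℂ (stabilizerCode S) = 2 ^ k ∧
    IsLeast (logicalWeights S) d

/-- The encoding rate `k / n` of the stabilizer code of `S`, where `n` is the number of qubits and
`2 ^ k` is the dimension of the code. -/
def encodingRate (S : Submonoid (Matrix (E → Fin 2) (E → Fin 2) ℂ)) : ℝ :=
  Real.logb 2 (Module.finrank ℂ (stabilizerCode S)) / Nat.card E

end Stabilizer

/-! ### The homological quantum code of a map -/

namespace CellComplex

variable {V E F : Type}

open Classical in
/-- The vertex-edge incidence matrix, that is, the matrix of `∂₁` over `ℤ₂`. -/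
def HX (K : CellComplex V E F) : Matrix V E (ZMod 2) :=
  Matrix.of fun v e => if K.endOf v e then 1 else 0

open Classical in
/-- The face-edge incidence matrix, that is, the transpose of the matrix of `∂₂` over `ℤ₂`. -/
def HZ (K : CellComplex V E F) : Matrix F E (ZMod 2) :=
  Matrix.of fun f e => if K.sideOf e f then 1 else 0

section Code

variable [Fintype E] [Fintype F]

/-- The first homology `ker ∂₁ / im ∂₂` over `ℤ₂`. -/
abbrev H1 (K : CellComplex V E F) : Type :=
  LinearMap.ker K.HX.mulVecLin ⧸
    (LinearMap.range K.HZᵀ.mulVecLin).submoduleOf (LinearMap.ker K.HX.mulVecLin)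

/-- The binary linear codes with parity-check matrices `HX` and `HZ`. -/
def codeX (K : CellComplex V E F) : Submodule (ZMod 2) (E → ZMod 2) :=
  LinearMap.ker K.HX.mulVecLin

def codeZ (K : CellComplex V E F) : Submodule (ZMod 2) (E → ZMod 2) :=
  LinearMap.ker K.HZ.mulVecLin

/-- The set `(C_X \ C_Z^⊥) ∪ (C_Z \ C_X^⊥)`. -/
def essentialWords (K : CellComplex V E F) : Set (E → ZMod 2) :=
  {x | (x ∈ K.codeX ∧ ¬ ∀ y ∈ K.codeZ, x ⬝ᵥ y = 0) ∨
    (x ∈ K.codeZ ∧ ¬ ∀ y ∈ K.codeX, x ⬝ᵥ y = 0)}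

open Classical in
/-- The operator `A_v`: the tensor product of `X` over the edges incident to `v`. -/
def vertexOp (K : CellComplex V E F) (v : V) : Matrix (E → Fin 2) (E → Fin 2) ℂ :=
  tensorOp fun e => if K.endOf v e then pauliX else pauliI

open Classical in
/-- The operator `B_f`: the tensor product of `Z` over the sides of `f`. -/
def faceOp (K : CellComplex V E F) (f : F) : Matrix (E → Fin 2) (E → Fin 2) ℂ :=
  tensorOp fun e => if K.sideOf e f then pauliZ else pauliI

variable [DecidableEq E]

/-- The group generated by the operators `A_v` and `B_f`. (They are involutions, so the monoid that
they generate is a group.) -/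
def stabilizer (K : CellComplex V E F) : Submonoid (Matrix (E → Fin 2) (E → Fin 2) ℂ) :=
  Submonoid.closure (Set.range K.vertexOp ∪ Set.range K.faceOp)

/-- `K` gives a homological quantum code with parameters `[[n, k, d]]`: the check matrices satisfy
`HX * HZᵀ = 0`; the stabilizer code of the operators `A_v`, `B_f` is an `[[n, k, d]]` quantum code;
`k` is the dimension of the first homology, and `d` is the minimum weight of a word of
`(C_X \ C_Z^⊥) ∪ (C_Z \ C_X^⊥)`. -/
def IsHomologicalCode (K : CellComplex V E F) (n k d : ℕ) : Prop :=
  K.HX * K.HZᵀ = 0 ∧ IsQuantumCode K.stabilizer n k d ∧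
    Module.finrank (ZMod 2) K.H1 = k ∧
    IsLeast {w | ∃ x ∈ K.essentialWords, w = hammingNorm x} d

end Code

end CellComplex

end

/-! ### The equivelar maps of type `[(2 m₁ - 1) ^ (2 m₁ - 1)]` -/

/-- The number `2 (3 ^ (m₁ - 1) + 2 m₂ - 1)` of vertices. -/
def oddMapOrder (m₁ m₂ : ℕ) : ℕ := 2 * (3 ^ (m₁ - 1) + 2 * m₂ - 1)

/-- The sequence `a_{2t+1} = 3 ^ t - 1`, `a_{2t+2} = 2 * 3 ^ t - 1`, numbered from `0`:
`offsetSeq i` is `a_{i+1}`. -/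
def offsetSeq (i : ℕ) : ℕ :=
  if i % 2 = 0 then 3 ^ (i / 2) - 1 else 2 * 3 ^ (i / 2) - 1

/-- The distance of the `(i+1)`-st vertex of the face `F_j` from `j`: it is `a_{i+1}`, with `m₂`
added for the last vertex but one, and `2 m₂` added for the last vertex. -/
def faceOffset (m₁ m₂ i : ℕ) : ℕ :=
  offsetSeq i + (if i + 2 = 2 * m₁ - 1 then m₂ else 0) + (if i + 1 = 2 * m₁ - 1 then 2 * m₂ else 0)

/-- The `(i+1)`-st vertex of the face `F_j`; vertices and faces are numbered by the residues modulo
`oddMapOrder m₁ m₂`. -/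
def faceVertex (m₁ m₂ : ℕ) (j : Fin (oddMapOrder m₁ m₂)) (i : ℕ) : Fin (oddMapOrder m₁ m₂) :=
  ⟨(j.val + faceOffset m₁ m₂ i) % oddMapOrder m₁ m₂, Nat.mod_lt _ j.pos⟩

/-- The `(i+1)`-st side of the face `F_j`; the face is a cycle with `2 m₁ - 1` vertices. -/
def faceSide (m₁ m₂ : ℕ) (j : Fin (oddMapOrder m₁ m₂)) (i : Fin (2 * m₁ - 1)) :
    Sym2 (Fin (oddMapOrder m₁ m₂)) :=
  s(faceVertex m₁ m₂ j i.val, faceVertex m₁ m₂ j ((i.val + 1) % (2 * m₁ - 1)))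

/-- The edges of the map are the sides of its faces. -/
def oddMapEdges (m₁ m₂ : ℕ) : Finset (Sym2 (Fin (oddMapOrder m₁ m₂))) :=
  Finset.univ.image fun x : Fin (oddMapOrder m₁ m₂) × Fin (2 * m₁ - 1) => faceSide m₁ m₂ x.1 x.2

/-- The map with the faces `F_j = (j + a_1, …, j + a_{p-2}, j + a_{p-1} + m₂, j + a_p + 2 m₂)`,
`p = 2 m₁ - 1`, where `j` runs through the residues modulo `oddMapOrder m₁ m₂`. -/
def oddMap (m₁ m₂ : ℕ) :
    CellComplex (Fin (oddMapOrder m₁ m₂)) (oddMapEdges m₁ m₂) (Fin (oddMapOrder m₁ m₂)) where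
  endOf v e := v ∈ e.val
  sideOf e j := ∃ i, e.val = faceSide m₁ m₂ j i

/-! Write N for `halfOrder` and s_t for `stepLength t`. Along a face `F_j` the successive sides have
lengths s_0, s_0, s_1, s_1, ..., s_{m₁-2}, s_{m₁-2}, and the last vertex is j + N, so the closing
side has length N = s_{m₁-1}. Hence the edges are exactly the pairs {x, x + s_t} with t < m₁ in the
cyclic group of order 2N. With o_i the offset of the vertex number i, the edge {x, x + s_t} lies on
the faces x - o_{2t} and x - o_{2t} - s_t. This description is symmetric: negating vertices and
faces and sending x to o_{2t} - x exchanges ends and sides (`oddMap_isSelfDual`). So only half of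
the map axioms need a direct check (`isMap_of_isSelfDual`).

Distance. The lengths satisfy 2 s_i < s_t for i < t < m₁ (`two_mul_stepLength_lt`), which rules out
every relation ±s_a ± s_b ± s_c = 0 modulo 2N. The graph is therefore simple and triangle-free, and
a nonzero cycle has weight at least 4 (`four_le_hammingNorm`); self-duality gives the same bound for
cocycles. The cycle 0, 1, N + 1, N attains it. It is essential because it shares exactly one edge,
{1, N + 1}, with the cocycle crossed by the faces 1, 2, N + 2, N + 1.

Dimension. A connected graph gives rank |V| - 1 for `HX`, and self-duality gives the same rank for
`HZ`, so k = |E| - 2(2N - 1), where |E| = (2m₁ - 1)N by double counting.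

The passage from operators to linear algebra uses that Pauli operators are, up to phase, X^a Z^b
with binary words a, b. The stabilizer is the set of X^a Z^b with a, b in the row spaces of `HX` and
`HZ` (`mem_stabilizer_iff`), and the code space is the space of functions on ker `HZ` modulo the row
space of `HX` (`stabilizerCodeEquiv`). -/

noncomputable section

/-! ### Pauli operators in symplectic form -/

lemma zmod_two_cases (x : ZMod 2) : x = 0 ∨ x = 1 := by
  revert x
  decide

/-- The sign `(-1) ^ x`. -/
def zsign (x : ZMod 2) : ℂ := if x = 0 then 1 else -1

@[simp] lemma zsign_zero : zsign 0 = 1 := if_pos rfl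

@[simp] lemma zsign_one : zsign 1 = -1 := if_neg one_ne_zero

lemma zmod_two_one_add_one : (1 : ZMod 2) + 1 = 0 := by decide

lemma zsign_add (x y : ZMod 2) : zsign (x + y) = zsign x * zsign y := by
  rcases zmod_two_cases x with rfl | rfl <;> rcases zmod_two_cases y with rfl | rfl <;>
    simp [zmod_two_one_add_one]

lemma zsign_sum {ι : Type} (s : Finset ι) (f : ι → ZMod 2) :
    zsign (∑ i ∈ s, f i) = ∏ i ∈ s, zsign (f i) := by
  classical
  induction s using Finset.induction_on with
  | empty => simp
  | insert a s ha ih => rw [Finset.sum_insert ha, Finset.prod_insert ha, zsign_add, ih]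

lemma zsign_eq_one {x : ZMod 2} : zsign x = 1 ↔ x = 0 := by
  rcases zmod_two_cases x with rfl | rfl <;> norm_num

lemma zsign_ne_zero (x : ZMod 2) : zsign x ≠ 0 := by
  rcases zmod_two_cases x with rfl | rfl <;> norm_num

/-- A bit, read as a residue modulo `2`. -/
def bit (i : Fin 2) : ZMod 2 := i

lemma bit_zero : bit 0 = 0 := rfl

lemma bit_one : bit 1 = 1 := rfl

/-- The one-qubit operator `X ^ a * Z ^ b`. -/
def qubitXZ (a b : ZMod 2) : Matrix (Fin 2) (Fin 2) ℂ :=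
  Matrix.of fun i j => if bit i = bit j + a then zsign (b * bit j) else 0

/-- The Pauli matrix that is a multiple of `X ^ a * Z ^ b`. -/
def pauliOf (a b : ZMod 2) : Matrix (Fin 2) (Fin 2) ℂ :=
  if a = 0 then (if b = 0 then pauliI else pauliZ) else (if b = 0 then pauliX else pauliY)

/-- The phase of `pauliOf a b` relative to `X ^ a * Z ^ b`. -/
def pauliPhase (a b : ZMod 2) : ℂ := if a = 0 ∨ b = 0 then 1 else Complex.I

lemma qubitXZ_zero_zero : qubitXZ 0 0 = !![1, 0; 0, 1] := by
  ext i j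
  fin_cases i <;> fin_cases j <;> simp [qubitXZ, bit_zero, bit_one]

lemma qubitXZ_zero_one : qubitXZ 0 1 = !![1, 0; 0, -1] := by
  ext i j
  fin_cases i <;> fin_cases j <;> simp [qubitXZ, bit_zero, bit_one]

lemma qubitXZ_one_zero : qubitXZ 1 0 = !![0, 1; 1, 0] := by
  ext i j
  fin_cases i <;> fin_cases j <;> simp [qubitXZ, bit_zero, bit_one, zmod_two_one_add_one]

lemma qubitXZ_one_one : qubitXZ 1 1 = !![0, -1; 1, 0] := by
  ext i j
  fin_cases i <;> fin_cases j <;> simp [qubitXZ, bit_zero, bit_one, zmod_two_one_add_one]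

lemma qubitXZ_mul (a b a' b' : ZMod 2) :
    qubitXZ a b * qubitXZ a' b' = zsign (b * a') • qubitXZ (a + a') (b + b') := by
  rcases zmod_two_cases a with rfl | rfl <;> rcases zmod_two_cases b with rfl | rfl <;>
  rcases zmod_two_cases a' with rfl | rfl <;> rcases zmod_two_cases b' with rfl | rfl <;>
    simp [zmod_two_one_add_one, qubitXZ_zero_zero, qubitXZ_zero_one, qubitXZ_one_zero,
      qubitXZ_one_one]

lemma pauliOf_eq (a b : ZMod 2) : pauliOf a b = pauliPhase a b • qubitXZ a b := by
  rcases zmod_two_cases a with rfl | rfl <;> rcases zmod_two_cases b with rfl | rfl <;>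
    simp [pauliOf, pauliPhase, qubitXZ_zero_zero, qubitXZ_zero_one, qubitXZ_one_zero,
      qubitXZ_one_one, pauliI, pauliX, pauliY, pauliZ]

/-- The phase of `pauliOf` cancels against its conjugate, leaving only the symplectic sign; this is
what turns commutation into orthogonality of binary words. -/
lemma pauliOf_conj (a b a' b' : ZMod 2) :
    pauliOf a b * qubitXZ a' b' * (pauliOf a b)ᴴ = zsign (b * a' + a * b') • qubitXZ a' b' := by
  rcases zmod_two_cases a with rfl | rfl <;> rcases zmod_two_cases b with rfl | rfl <;>
  rcases zmod_two_cases a' with rfl | rfl <;> rcases zmod_two_cases b' with rfl | rfl <;>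
    ext i j <;> fin_cases i <;> fin_cases j <;>
    simp [pauliOf, zmod_two_one_add_one, qubitXZ_zero_zero, qubitXZ_zero_one, qubitXZ_one_zero,
      qubitXZ_one_one, pauliI, pauliX, pauliY, pauliZ, Matrix.mul_apply, Fin.sum_univ_two]

lemma pauliOf_mem (a b : ZMod 2) : pauliOf a b ∈ pauliMatrices := by
  unfold pauliOf pauliMatrices
  split_ifs <;> simp

lemma exists_pauliOf {M : Matrix (Fin 2) (Fin 2) ℂ} (h : M ∈ pauliMatrices) :
    ∃ a b, M = pauliOf a b := by
  rcases h with rfl | rfl | rfl | rfl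
  · exact ⟨0, 0, by simp [pauliOf]⟩
  · exact ⟨1, 0, by simp [pauliOf]⟩
  · exact ⟨1, 1, by simp [pauliOf]⟩
  · exact ⟨0, 1, by simp [pauliOf]⟩

lemma pauliOf_zero_zero : pauliOf 0 0 = pauliI := by simp [pauliOf]

lemma pauliOf_eq_pauliI_iff {a b : ZMod 2} : pauliOf a b = pauliI ↔ a = 0 ∧ b = 0 := by
  constructor
  · intro h
    have h00 := congrFun (congrFun h 0) 0
    have h11 := congrFun (congrFun h 1) 1
    revert h00 h11
    rcases zmod_two_cases a with rfl | rfl <;> rcases zmod_two_cases b with rfl | rfl <;>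
      norm_num [pauliOf, pauliI, pauliX, pauliY, pauliZ]
  · rintro ⟨rfl, rfl⟩
    exact pauliOf_zero_zero

lemma one_mem_pauliPhases : (1 : ℂ) ∈ pauliPhases := Or.inl rfl

lemma mul_mem_pauliPhases {c c' : ℂ} (h : c ∈ pauliPhases) (h' : c' ∈ pauliPhases) :
    c * c' ∈ pauliPhases := by
  rcases h with rfl | rfl | rfl | rfl <;> rcases h' with rfl | rfl | rfl | rfl <;>
    simp [pauliPhases]

lemma inv_mem_pauliPhases {c : ℂ} (h : c ∈ pauliPhases) : c⁻¹ ∈ pauliPhases := by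
  rcases h with rfl | rfl | rfl | rfl <;> simp [pauliPhases, inv_neg]

lemma ne_zero_of_mem_pauliPhases {c : ℂ} (h : c ∈ pauliPhases) : c ≠ 0 := by
  rcases h with rfl | rfl | rfl | rfl <;> simp

lemma pauliPhase_mem (a b : ZMod 2) : pauliPhase a b ∈ pauliPhases := by
  unfold pauliPhase pauliPhases
  split_ifs <;> simp

/-! ### Pauli operators on several qubits as pairs of binary words. -/

section Tensor

variable {E : Type} [Fintype E] [DecidableEq E]

lemma tensorOp_mul (A B : E → Matrix (Fin 2) (Fin 2) ℂ) :
    tensorOp A * tensorOp B = tensorOp fun e => A e * B e := by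
  ext i j
  simp only [tensorOp, Matrix.mul_apply, Matrix.of_apply, ← Finset.prod_mul_distrib]
  rw [Finset.prod_univ_sum, Fintype.piFinset_univ]

omit [DecidableEq E] in
lemma tensorOp_smul (c : E → ℂ) (A : E → Matrix (Fin 2) (Fin 2) ℂ) :
    tensorOp (fun e => c e • A e) = (∏ e, c e) • tensorOp A := by
  ext i j
  simp [tensorOp, Finset.prod_mul_distrib]

omit [DecidableEq E] in
lemma tensorOp_conjTranspose (A : E → Matrix (Fin 2) (Fin 2) ℂ) :
    (tensorOp A)ᴴ = tensorOp fun e => (A e)ᴴ := by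
  ext i j
  simp [tensorOp, Matrix.conjTranspose_apply]

/-- The operator `X ^ a * Z ^ b` on the qubits indexed by `E`. -/
def wordXZ (a b : E → ZMod 2) : Matrix (E → Fin 2) (E → Fin 2) ℂ :=
  tensorOp fun e => qubitXZ (a e) (b e)

/-- A basis state, read as a binary word. -/
def bits (i : E → Fin 2) : E → ZMod 2 := fun e => bit (i e)

lemma wordXZ_mul (a b a' b' : E → ZMod 2) :
    wordXZ a b * wordXZ a' b' = zsign (b ⬝ᵥ a') • wordXZ (a + a') (b + b') := by
  simp only [wordXZ, tensorOp_mul, qubitXZ_mul, tensorOp_smul, dotProduct, zsign_sum]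
  rfl

omit [DecidableEq E] in
lemma wordXZ_apply (a b : E → ZMod 2) (i j : E → Fin 2) :
    wordXZ a b i j = if bits i = bits j + a then zsign (b ⬝ᵥ bits j) else 0 := by
  simp only [wordXZ, tensorOp, qubitXZ, Matrix.of_apply, dotProduct, zsign_sum]
  split_ifs with h
  · exact Finset.prod_congr rfl fun e _ => if_pos (congrFun h e)
  · obtain ⟨e, he⟩ : ∃ e, bit (i e) ≠ bit (j e) + a e := by
      by_contra! hc
      exact h (funext hc)
    exact Finset.prod_eq_zero (Finset.mem_univ e) (if_neg he)

omit [Fintype E] [DecidableEq E] in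
lemma bits_injective : Function.Injective (bits : (E → Fin 2) → E → ZMod 2) := fun _ _ h => h

omit [Fintype E] [DecidableEq E] in
lemma bits_surjective : Function.Surjective (bits : (E → Fin 2) → E → ZMod 2) :=
  fun x => ⟨x, rfl⟩

omit [DecidableEq E] in
lemma wordXZ_zero : wordXZ (0 : E → ZMod 2) 0 = 1 := by
  ext i j
  simp [wordXZ_apply, Matrix.one_apply, bits_injective.eq_iff]

omit [DecidableEq E] in
lemma tensorOp_pauliOf (a b : E → ZMod 2) :
    tensorOp (fun e => pauliOf (a e) (b e)) = (∏ e, pauliPhase (a e) (b e)) • wordXZ a b := by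
  simp only [pauliOf_eq, tensorOp_smul, wordXZ]

omit [DecidableEq E] in
lemma prod_pauliPhase_mem (a b : E → ZMod 2) : ∏ e, pauliPhase (a e) (b e) ∈ pauliPhases :=
  Finset.prod_induction _ (· ∈ pauliPhases) (fun _ _ => mul_mem_pauliPhases) one_mem_pauliPhases
    fun _ _ => pauliPhase_mem _ _

omit [DecidableEq E] in
lemma wordXZ_mem_pauliGroup (a b : E → ZMod 2) : wordXZ a b ∈ pauliGroup E := by
  have h := prod_pauliPhase_mem a b
  refine ⟨_, inv_mem_pauliPhases h, _, fun e => pauliOf_mem (a e) (b e), ?_⟩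
  rw [tensorOp_pauliOf, inv_smul_smul₀ (ne_zero_of_mem_pauliPhases h)]

lemma tensorOp_conj (a b a' b' : E → ZMod 2) :
    tensorOp (fun e => pauliOf (a e) (b e)) * wordXZ a' b' *
      (tensorOp fun e => pauliOf (a e) (b e))ᴴ = zsign (b ⬝ᵥ a' + a ⬝ᵥ b') • wordXZ a' b' := by
  simp only [wordXZ, tensorOp_conjTranspose, tensorOp_mul, pauliOf_conj, tensorOp_smul, dotProduct,
    ← Finset.sum_add_distrib, zsign_sum]

omit [DecidableEq E] in
-- Lets the phase and both words be read off from an operator, so that membership in the stabilizer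
-- becomes membership in row spaces and -1 is seen not to be a stabilizer element.
lemma smul_wordXZ_inj {c c' : ℂ} {a b a' b' : E → ZMod 2} (hc : c ≠ 0)
    (h : c • wordXZ a b = c' • wordXZ a' b') : c = c' ∧ a = a' ∧ b = b' := by
  have key : ∀ i j : E → ZMod 2, c * (if i = j + a then zsign (b ⬝ᵥ j) else 0) =
      c' * (if i = j + a' then zsign (b' ⬝ᵥ j) else 0) := by
    intro i j
    obtain ⟨i, rfl⟩ := bits_surjective i
    obtain ⟨j, rfl⟩ := bits_surjective j
    have := congrFun (congrFun h i) j
    simpa [wordXZ_apply] using this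
  have ha : a = a' := by
    by_contra hne
    -- The column 0 of X^a Z^b has its only nonzero entry, equal to 1, in row a; it determines both
    -- a and the phase.
    have := key a 0
    rw [if_pos (by simp), if_neg (by simpa using hne)] at this
    simp [hc] at this
  subst ha
  have hcc : c = c' := by simpa using key a 0
  subst hcc
  refine ⟨rfl, rfl, ?_⟩
  classical
  funext e
  -- The nonzero entry in the column of the unit word at e is the sign of b e.
  have := key (Pi.single e 1 + a) (Pi.single e 1)
  rw [if_pos rfl, if_pos rfl, mul_right_inj' hc, dotProduct_single_one, dotProduct_single_one] at this
  rcases zmod_two_cases (b e) with hb | hb <;> rcases zmod_two_cases (b' e) with hb' | hb' <;>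
    rw [hb, hb'] at this ⊢ <;> norm_num at this

lemma wordXZ_mulVec (a b : E → ZMod 2) (ψ : (E → Fin 2) → ℂ) (i j : E → Fin 2)
    (hij : bits i = bits j + a) : (wordXZ a b *ᵥ ψ) i = zsign (b ⬝ᵥ bits j) * ψ j := by
  rw [Matrix.mulVec, dotProduct, Finset.sum_eq_single j]
  · rw [wordXZ_apply, if_pos hij]
  · intro k _ hk
    rw [wordXZ_apply, if_neg, zero_mul]
    intro hik
    exact hk (bits_injective (add_right_cancel (hik.symm.trans hij)))
  · simp

end Tensor

end

noncomputable section

/-! ### The stabilizer code of a pair of orthogonal check matrices -/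

namespace CellComplex

variable {V E F : Type}

/-- The row space of `HX`. -/
def rowX (K : CellComplex V E F) : Submodule (ZMod 2) (E → ZMod 2) :=
  Submodule.span (ZMod 2) (Set.range K.HX)

/-- The row space of `HZ`. -/
def rowZ (K : CellComplex V E F) : Submodule (ZMod 2) (E → ZMod 2) :=
  Submodule.span (ZMod 2) (Set.range K.HZ)

variable [Fintype E]

lemma dotProduct_eq_zero_of_mem_span {s : Set (E → ZMod 2)} {x b : E → ZMod 2}
    (h : ∀ r ∈ s, r ⬝ᵥ x = 0) (hb : b ∈ Submodule.span (ZMod 2) s) : b ⬝ᵥ x = 0 := by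
  induction hb using Submodule.span_induction with
  | mem r hr => exact h r hr
  | zero => exact zero_dotProduct x
  | add r r' _ _ h h' => rw [add_dotProduct, h, h', add_zero]
  | smul c r _ h => rw [smul_dotProduct, h, smul_zero]

lemma mem_codeX_iff (K : CellComplex V E F) (x : E → ZMod 2) :
    x ∈ K.codeX ↔ ∀ a ∈ K.rowX, a ⬝ᵥ x = 0 := by
  rw [codeX, LinearMap.mem_ker, Matrix.mulVecLin_apply]
  constructor
  · intro h a ha
    refine dotProduct_eq_zero_of_mem_span ?_ ha
    rintro _ ⟨v, rfl⟩
    exact congrFun h v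
  · intro h
    funext v
    exact h _ (Submodule.subset_span ⟨v, rfl⟩)

lemma mem_codeZ_iff (K : CellComplex V E F) (x : E → ZMod 2) :
    x ∈ K.codeZ ↔ ∀ b ∈ K.rowZ, b ⬝ᵥ x = 0 := by
  rw [codeZ, LinearMap.mem_ker, Matrix.mulVecLin_apply]
  constructor
  · intro h a ha
    refine dotProduct_eq_zero_of_mem_span ?_ ha
    rintro _ ⟨v, rfl⟩
    exact congrFun h v
  · intro h
    funext v
    exact h _ (Submodule.subset_span ⟨v, rfl⟩)

lemma rowX_le_codeZ (K : CellComplex V E F) (h : K.HX * K.HZᵀ = 0) : K.rowX ≤ K.codeZ := by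
  rw [rowX, Submodule.span_le]
  rintro _ ⟨v, rfl⟩
  change K.HZ *ᵥ _ = 0
  funext f
  rw [Matrix.mulVec, dotProduct_comm]
  exact congrFun (congrFun h v) f

lemma dotProduct_eq_zero_of_mem_row (K : CellComplex V E F) (h : K.HX * K.HZᵀ = 0)
    {a b : E → ZMod 2} (ha : a ∈ K.rowX) (hb : b ∈ K.rowZ) : b ⬝ᵥ a = 0 :=
  (K.mem_codeZ_iff a).1 (K.rowX_le_codeZ h ha) b hb

lemma vertexOp_eq (K : CellComplex V E F) (v : V) : K.vertexOp v = wordXZ (K.HX v) 0 := by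
  classical
  unfold vertexOp wordXZ
  congr 1
  funext e
  by_cases h : K.endOf v e
  · simp [HX, h, qubitXZ_one_zero, pauliX]
  · simp [HX, h, qubitXZ_zero_zero, pauliI]

lemma faceOp_eq (K : CellComplex V E F) (f : F) : K.faceOp f = wordXZ 0 (K.HZ f) := by
  classical
  unfold faceOp wordXZ
  congr 1
  funext e
  by_cases h : K.sideOf e f
  · simp [HZ, h, qubitXZ_zero_one, pauliZ]
  · simp [HZ, h, qubitXZ_zero_zero, pauliI]

variable [DecidableEq E]

lemma wordXZ_mem_of_mem_span {S : Submonoid (Matrix (E → Fin 2) (E → Fin 2) ℂ)}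
    {s : Set (E → ZMod 2)} (h : ∀ r ∈ s, wordXZ r 0 ∈ S) {a : E → ZMod 2}
    (ha : a ∈ Submodule.span (ZMod 2) s) : wordXZ a 0 ∈ S := by
  induction ha using Submodule.span_induction with
  | mem r hr => exact h r hr
  | zero => rw [wordXZ_zero]; exact S.one_mem
  | add r r' _ _ h h' => simpa [wordXZ_mul] using S.mul_mem h h'
  | smul c r _ h =>
    rcases zmod_two_cases c with rfl | rfl
    · rw [zero_smul, wordXZ_zero]; exact S.one_mem
    · rwa [one_smul]

lemma wordXZ_mem_of_mem_span' {S : Submonoid (Matrix (E → Fin 2) (E → Fin 2) ℂ)}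
    {s : Set (E → ZMod 2)} (h : ∀ r ∈ s, wordXZ 0 r ∈ S) {b : E → ZMod 2}
    (hb : b ∈ Submodule.span (ZMod 2) s) : wordXZ 0 b ∈ S := by
  induction hb using Submodule.span_induction with
  | mem r hr => exact h r hr
  | zero => rw [wordXZ_zero]; exact S.one_mem
  | add r r' _ _ h h' => simpa [wordXZ_mul] using S.mul_mem h h'
  | smul c r _ h =>
    rcases zmod_two_cases c with rfl | rfl
    · rw [zero_smul, wordXZ_zero]; exact S.one_mem
    · rwa [one_smul]

/-- The stabilizer group consists of the operators `X ^ a * Z ^ b` with `a` and `b` in the row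
spaces of the check matrices. -/
lemma mem_stabilizer_iff (K : CellComplex V E F) (h : K.HX * K.HZᵀ = 0)
    (M : Matrix (E → Fin 2) (E → Fin 2) ℂ) :
    M ∈ K.stabilizer ↔ ∃ a ∈ K.rowX, ∃ b ∈ K.rowZ, M = wordXZ a b := by
  constructor
  · intro hM
    induction hM using Submonoid.closure_induction with
    | mem M hM =>
      rcases hM with ⟨v, rfl⟩ | ⟨f, rfl⟩
      · exact ⟨_, Submodule.subset_span ⟨v, rfl⟩, 0, zero_mem _, K.vertexOp_eq v⟩
      · exact ⟨0, zero_mem _, _, Submodule.subset_span ⟨f, rfl⟩, K.faceOp_eq f⟩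
    | one => exact ⟨0, zero_mem _, 0, zero_mem _, wordXZ_zero.symm⟩
    | mul M M' _ _ hM hM' =>
      obtain ⟨a, ha, b, hb, rfl⟩ := hM
      obtain ⟨a', ha', b', hb', rfl⟩ := hM'
      refine ⟨a + a', add_mem ha ha', b + b', add_mem hb hb', ?_⟩
      -- Orthogonality of the two row spaces kills the sign of the product, so no phase ever appears
      -- in the stabilizer.
      rw [wordXZ_mul, K.dotProduct_eq_zero_of_mem_row h ha' hb, zsign_zero, one_smul]
  · rintro ⟨a, ha, b, hb, rfl⟩
    have hX : wordXZ a 0 ∈ K.stabilizer := wordXZ_mem_of_mem_span (by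
      rintro _ ⟨v, rfl⟩
      rw [← vertexOp_eq]
      exact Submonoid.subset_closure (Or.inl ⟨v, rfl⟩)) ha
    have hZ : wordXZ 0 b ∈ K.stabilizer := wordXZ_mem_of_mem_span' (by
      rintro _ ⟨f, rfl⟩
      rw [← faceOp_eq]
      exact Submonoid.subset_closure (Or.inr ⟨f, rfl⟩)) hb
    simpa [wordXZ_mul] using mul_mem hX hZ

lemma isStabilizerGroup_stabilizer (K : CellComplex V E F) (h : K.HX * K.HZᵀ = 0) :
    IsStabilizerGroup K.stabilizer := by
  constructor
  · intro M hM
    obtain ⟨a, -, b, -, rfl⟩ := (K.mem_stabilizer_iff h M).1 hM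
    exact wordXZ_mem_pauliGroup a b
  · intro hM
    obtain ⟨a, -, b, -, hab⟩ := (K.mem_stabilizer_iff h _).1 hM
    have := smul_wordXZ_inj (c := -1) (c' := 1) (a := 0) (b := 0) (a' := a) (b' := b)
      (by norm_num) (by rw [wordXZ_zero, one_smul, ← hab, neg_one_smul])
    norm_num at this

/-- X-type stabilizers translate basis states by the row space of `HX`; Z-type stabilizers multiply
a basis state by a sign, which is always 1 only on ker `HZ`. -/
lemma mem_stabilizerCode_iff (K : CellComplex V E F) (h : K.HX * K.HZᵀ = 0)
    (ψ : (E → Fin 2) → ℂ) :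
    ψ ∈ stabilizerCode K.stabilizer ↔
      (∀ i j, bits i - bits j ∈ K.rowX → ψ i = ψ j) ∧ ∀ i, bits i ∉ K.codeZ → ψ i = 0 := by
  constructor
  · intro hψ
    constructor
    · intro i j hij
      have h1 := hψ (wordXZ (bits i - bits j) 0)
        ((K.mem_stabilizer_iff h _).2 ⟨_, hij, 0, zero_mem _, rfl⟩)
      have h2 := wordXZ_mulVec (bits i - bits j) 0 ψ i j (by abel)
      rw [h1, zero_dotProduct, zsign_zero, one_mul] at h2
      exact h2
    · intro i hi
      rw [mem_codeZ_iff] at hi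
      push Not at hi
      obtain ⟨b, hb, hbi⟩ := hi
      have h1 := hψ (wordXZ 0 b) ((K.mem_stabilizer_iff h _).2 ⟨0, zero_mem _, b, hb, rfl⟩)
      have h2 := wordXZ_mulVec 0 b ψ i i (by simp)
      rw [h1] at h2
      by_contra h0
      exact hbi (zsign_eq_one.1 (mul_right_cancel₀ h0 (by rw [one_mul]; exact h2.symm)))
  · rintro ⟨h1, h2⟩ M hM
    obtain ⟨a, ha, b, hb, rfl⟩ := (K.mem_stabilizer_iff h M).1 hM
    funext i
    obtain ⟨j, hj⟩ := bits_surjective (bits i - a)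
    have hij : bits i - bits j = a := by rw [hj]; abel
    rw [wordXZ_mulVec a b ψ i j (by rw [hj]; abel), h1 i j (hij ▸ ha)]
    by_cases hc : bits j ∈ K.codeZ
    · rw [(K.mem_codeZ_iff _).1 hc b hb, zsign_zero, one_mul]
    · rw [h2 j hc, mul_zero]

/-- A state of the code is a function on the quotient of `ker HZ` by the row space of `HX`. -/
def stabilizerCodeEquiv (K : CellComplex V E F) (h : K.HX * K.HZᵀ = 0) :
    stabilizerCode K.stabilizer ≃ₗ[ℂ] (K.codeZ ⧸ K.rowX.submoduleOf K.codeZ) → ℂ := by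
  classical
  exact
  -- A state is evaluated at a chosen representative of the coset; a binary word serves as a basis
  -- state because `ZMod 2` and `Fin 2` agree definitionally.
  { toFun := fun ψ q => ψ.1 fun e => (Quotient.out q).1 e
    map_add' := fun _ _ => rfl
    map_smul' := fun _ _ => rfl
    invFun := fun φ => ⟨fun i => if hi : bits i ∈ K.codeZ then φ (Submodule.Quotient.mk ⟨_, hi⟩)
      else 0, by
        rw [K.mem_stabilizerCode_iff h]
        constructor
        · intro i j hij
          have hiff : bits i ∈ K.codeZ ↔ bits j ∈ K.codeZ := by
            have := K.rowX_le_codeZ h hij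
            constructor
            · intro hi
              simpa using sub_mem hi this
            · intro hj
              simpa using add_mem this hj
          by_cases hi : bits i ∈ K.codeZ
          · simp only [dif_pos hi, dif_pos (hiff.1 hi)]
            congr 1
            rw [Submodule.Quotient.eq]
            exact hij
          · simp only [dif_neg hi, dif_neg (mt hiff.2 hi)]
        · intro i hi
          exact dif_neg hi⟩
    left_inv := by
      rintro ⟨ψ, hψ⟩
      rw [K.mem_stabilizerCode_iff h] at hψ
      ext i
      by_cases hi : bits i ∈ K.codeZ
      · simp only [dif_pos hi]
        apply hψ.1
        have := Quotient.out_eq (Submodule.Quotient.mk (p := K.rowX.submoduleOf K.codeZ) ⟨_, hi⟩)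
        exact (Submodule.Quotient.eq (K.rowX.submoduleOf K.codeZ)).1 this
      · simp only [dif_neg hi]
        exact (hψ.2 i hi).symm
    right_inv := by
      intro φ
      funext q
      have hq : bits (fun e => (Quotient.out q).1 e) ∈ K.codeZ := (Quotient.out q).2
      simp only
      rw [dif_pos hq]
      congr 1
      exact Quotient.out_eq q }

lemma finrank_stabilizerCode (K : CellComplex V E F) (h : K.HX * K.HZᵀ = 0) :
    Module.finrank ℂ (stabilizerCode K.stabilizer) =
      2 ^ (Module.finrank (ZMod 2) K.codeZ - Module.finrank (ZMod 2) K.rowX) := by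
  have : Finite (K.codeZ ⧸ K.rowX.submoduleOf K.codeZ) :=
    Finite.of_surjective _ (Submodule.mkQ_surjective _)
  have : Fintype (K.codeZ ⧸ K.rowX.submoduleOf K.codeZ) := Fintype.ofFinite _
  rw [(K.stabilizerCodeEquiv h).finrank_eq, Module.finrank_fintype_fun_eq_card,
    Module.card_eq_pow_finrank (K := ZMod 2), ZMod.card]
  congr 1
  have h1 := Submodule.finrank_quotient_add_finrank (K.rowX.submoduleOf K.codeZ)
  have h2 := (Submodule.submoduleOfEquivOfLe (K.rowX_le_codeZ h)).finrank_eq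
  omega

/-- The minimum distance, from a lower bound for the weights of the words in the two codes and two
words of these codes that are not orthogonal. -/
lemma isLeast_logicalWeights (K : CellComplex V E F) (h : K.HX * K.HZᵀ = 0) {d : ℕ}
    (hX : ∀ x ∈ K.codeX, x ≠ 0 → d ≤ hammingNorm x) (hZ : ∀ x ∈ K.codeZ, x ≠ 0 → d ≤ hammingNorm x)
    {x y : E → ZMod 2} (hx : x ∈ K.codeX) (hy : y ∈ K.codeZ) (hxy : x ⬝ᵥ y ≠ 0)
    (hd : hammingNorm x = d) : IsLeast (logicalWeights K.stabilizer) d := by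
  constructor
  -- The witness is Z^x. It commutes with the stabilizer since x is in ker `HX`; were a multiple of
  -- it a stabilizer element, x would lie in the row space of `HZ` and be orthogonal to y.
  · refine ⟨fun e => pauliOf 0 (x e), fun e => pauliOf_mem _ _, ?_, ?_, ?_⟩
    · intro g hg
      obtain ⟨a, ha, b, hb, rfl⟩ := (K.mem_stabilizer_iff h g).1 hg
      have := tensorOp_conj 0 x a b
      rwa [zero_dotProduct, dotProduct_comm, (K.mem_codeX_iff x).1 hx a ha, add_zero, zsign_zero,
        one_smul] at this
    · intro c hc hmem
      obtain ⟨a, ha, b, hb, hab⟩ := (K.mem_stabilizer_iff h _).1 hmem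
      have ht := tensorOp_pauliOf 0 x
      have h0 := ne_zero_of_mem_pauliPhases (prod_pauliPhase_mem 0 x)
      simp only [Pi.zero_apply] at ht h0
      rw [ht, smul_smul] at hab
      obtain ⟨-, -, rfl⟩ := smul_wordXZ_inj (c' := 1)
        (mul_ne_zero (ne_zero_of_mem_pauliPhases hc) h0) (by rw [one_smul]; exact hab)
      exact hxy ((K.mem_codeZ_iff y).1 hy x hb)
    · rw [← hd, hammingNorm, ← Set.ncard_coe_finset]
      congr 1
      ext e
      simp [pauliOf_eq_pauliI_iff]
  · rintro w ⟨A, hA, hcomm, hS, rfl⟩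
    choose a b hab using fun e => exists_pauliOf (hA e)
    obtain rfl : A = fun e => pauliOf (a e) (b e) := funext hab
    have hsign : ∀ a' ∈ K.rowX, ∀ b' ∈ K.rowZ, b ⬝ᵥ a' + a ⬝ᵥ b' = 0 := by
      intro a' ha' b' hb'
      have h1 := hcomm (wordXZ a' b') ((K.mem_stabilizer_iff h _).2 ⟨a', ha', b', hb', rfl⟩)
      rw [tensorOp_conj] at h1
      have h2 := smul_wordXZ_inj (c' := 1) (zsign_ne_zero _) (by rw [one_smul]; exact h1)
      exact zsign_eq_one.1 h2.1
    have haZ : a ∈ K.codeZ := (K.mem_codeZ_iff a).2 fun b' hb' => by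
      simpa [dotProduct_comm] using hsign 0 (zero_mem _) b' hb'
    have hbX : b ∈ K.codeX := (K.mem_codeX_iff b).2 fun a' ha' => by
      simpa [dotProduct_comm] using hsign a' ha' 0 (zero_mem _)
    -- The weight of X^a Z^b is the size of the union of the supports of a and b, hence at least the
    -- weight of each. One of the two words is nonzero, since otherwise the operator is the
    -- identity.
    have hle : ∀ x : E → ZMod 2, (∀ e, x e ≠ 0 → pauliOf (a e) (b e) ≠ pauliI) →
        hammingNorm x ≤ {e | pauliOf (a e) (b e) ≠ pauliI}.ncard := by
      intro x hx
      rw [hammingNorm, ← Set.ncard_coe_finset]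
      exact Set.ncard_le_ncard (fun e he => hx e (by simpa using he)) (Set.toFinite _)
    by_cases ha0 : a = 0
    · by_cases hb0 : b = 0
      · exfalso
        refine hS 1 one_mem_pauliPhases ?_
        have : tensorOp (fun e => pauliOf (a e) (b e)) = 1 := by
          rw [tensorOp_pauliOf, ha0, hb0, wordXZ_zero]
          simp [pauliPhase]
        rw [this, one_smul]
        exact one_mem _
      · exact (hX b hbX hb0).trans (hle b fun e he => by
          simp [pauliOf_eq_pauliI_iff, he])
    · exact (hZ a haZ ha0).trans (hle a fun e he => by
        simp [pauliOf_eq_pauliI_iff, he])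

omit [DecidableEq E] in
lemma isLeast_essentialWords (K : CellComplex V E F) {d : ℕ}
    (hX : ∀ x ∈ K.codeX, x ≠ 0 → d ≤ hammingNorm x) (hZ : ∀ x ∈ K.codeZ, x ≠ 0 → d ≤ hammingNorm x)
    {x y : E → ZMod 2} (hx : x ∈ K.codeX) (hy : y ∈ K.codeZ) (hxy : x ⬝ᵥ y ≠ 0)
    (hd : hammingNorm x = d) : IsLeast {w | ∃ x ∈ K.essentialWords, w = hammingNorm x} d := by
  constructor
  · exact ⟨x, Or.inl ⟨hx, fun h => hxy (h y hy)⟩, hd.symm⟩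
  · rintro w ⟨z, hz, rfl⟩
    rcases hz with ⟨hz, h0⟩ | ⟨hz, h0⟩
    · refine hX z hz ?_
      rintro rfl
      exact h0 fun y _ => zero_dotProduct y
    · refine hZ z hz ?_
      rintro rfl
      exact h0 fun y _ => zero_dotProduct y

end CellComplex

end

noncomputable section

/-! ### Homology and small cycles of a complex -/

namespace CellComplex

variable {V E F : Type}

/-- Each entry counts modulo 2 the sides of a face at a vertex: two at a corner, none otherwise. -/
lemma HX_mul_HZ_transpose [Fintype E] (K : CellComplex V E F)
    (h : ∀ v f, K.onFace v f → {e | K.endOf v e ∧ K.sideOf e f}.ncard = 2) :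
    K.HX * K.HZᵀ = 0 := by
  classical
  ext v f
  have hsum : (K.HX * K.HZᵀ) v f = ({e | K.endOf v e ∧ K.sideOf e f}.ncard : ZMod 2) := by
    rw [Set.ncard_eq_toFinset_card', Matrix.mul_apply, Set.toFinset_ofPred, Finset.card_filter,
      Nat.cast_sum]
    refine Finset.sum_congr rfl fun e _ => ?_
    by_cases h1 : K.endOf v e <;> by_cases h2 : K.sideOf e f <;> simp [HX, HZ, h1, h2]
  rw [hsum, Matrix.zero_apply]
  by_cases hvf : K.onFace v f
  · rw [h v f hvf]
    rfl
  · have : {e | K.endOf v e ∧ K.sideOf e f} = ∅ :=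
      Set.eq_empty_of_forall_notMem fun e he => hvf ⟨e, he⟩
    rw [this]
    simp

lemma exists_ends (K : CellComplex V E F) (h : ∀ e, {v | K.endOf v e}.ncard = 2) (e : E) :
    ∃ u v, u ≠ v ∧ ∀ w, K.endOf w e ↔ w = u ∨ w = v := by
  obtain ⟨u, v, huv, hs⟩ := Set.ncard_eq_two.1 (h e)
  exact ⟨u, v, huv, fun w => Set.ext_iff.1 hs w⟩

lemma exists_other_end (K : CellComplex V E F) (h : ∀ e, {v | K.endOf v e}.ncard = 2) {e : E}
    {v : V} (hv : K.endOf v e) : ∃ w, w ≠ v ∧ ∀ u, K.endOf u e ↔ u = v ∨ u = w := by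
  obtain ⟨a, b, hab, hs⟩ := K.exists_ends h e
  rcases (hs v).1 hv with rfl | rfl
  · exact ⟨b, hab.symm, hs⟩
  · exact ⟨a, hab, fun u => (hs u).trans or_comm⟩

/-- The coboundary of a function on the vertices. -/
lemma HX_transpose_mulVec [Fintype V] (K : CellComplex V E F) {e : E} {u v : V} (huv : u ≠ v)
    (hs : ∀ w, K.endOf w e ↔ w = u ∨ w = v) (g : V → ZMod 2) : (K.HXᵀ *ᵥ g) e = g u + g v := by
  classical
  rw [Matrix.mulVec, dotProduct, ← Finset.sum_pair huv]
  refine (Finset.sum_subset_zero_on_sdiff (Finset.subset_univ _) ?_ ?_).symm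
  · intro w hw
    have hw' : ¬ (w = u ∨ w = v) := by simpa using hw
    simp [HX, (hs w).not.2 hw']
  · intro w hw
    have hw' : w = u ∨ w = v := by simpa using hw
    simp [HX, (hs w).2 hw']

/-- A function on the vertices with zero coboundary agrees at the two ends of every edge, so by
connectedness it is constant: the kernel of the transpose is one-dimensional. -/
lemma rank_HX [Fintype V] [Fintype E] [Nonempty V] (K : CellComplex V E F)
    (h : ∀ e, {v | K.endOf v e}.ncard = 2)
    (hc : ∀ v w, Relation.ReflTransGen (fun a b => ∃ e, K.endOf a e ∧ K.endOf b e) v w) :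
    K.HX.rank = Fintype.card V - 1 := by
  have hker : Module.finrank (ZMod 2) (LinearMap.ker K.HXᵀ.mulVecLin) = 1 := by
    have hmem : ∀ g : V → ZMod 2, g ∈ LinearMap.ker K.HXᵀ.mulVecLin ↔
        ∀ v w, g v = g w := by
      intro g
      rw [LinearMap.mem_ker, Matrix.mulVecLin_apply]
      constructor
      · intro hg v w
        induction hc v w with
        | refl => rfl
        | tail _ hstep ih =>
          obtain ⟨e, h1, h2⟩ := hstep
          rw [ih]
          obtain ⟨a, b, hab, hs⟩ := K.exists_ends h e
          have h0 : g a + g b = 0 := by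
            rw [← K.HX_transpose_mulVec hab hs, hg, Pi.zero_apply]
          have h0' : g a = g b := CharTwo.add_eq_zero.1 h0
          rcases (hs _).1 h1 with rfl | rfl <;> rcases (hs _).1 h2 with rfl | rfl <;>
            simp [h0']
      · intro hg
        funext e
        obtain ⟨a, b, hab, hs⟩ := K.exists_ends h e
        rw [K.HX_transpose_mulVec hab hs, hg a b, CharTwo.add_self_eq_zero, Pi.zero_apply]
    have hone : (fun _ => 1 : V → ZMod 2) ∈ LinearMap.ker K.HXᵀ.mulVecLin :=
      (hmem _).2 fun _ _ => rfl
    obtain ⟨v₀⟩ := ‹Nonempty V›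
    refine finrank_eq_one ⟨_, hone⟩ ?_ ?_
    · intro h0
      exact one_ne_zero (congrFun (congrArg Subtype.val h0) v₀)
    · rintro ⟨g, hg⟩
      refine ⟨g v₀, Subtype.ext (funext fun v => ?_)⟩
      simpa using (hmem g).1 hg v₀ v
  have h1 := K.HXᵀ.mulVecLin.finrank_range_add_finrank_ker
  rw [hker, Module.finrank_fintype_fun_eq_card] at h1
  rw [← Matrix.rank_transpose, Matrix.rank]
  omega

lemma finrank_codeX [Fintype E] (K : CellComplex V E F) :
    Module.finrank (ZMod 2) K.codeX = Fintype.card E - K.HX.rank := by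
  have h1 := K.HX.mulVecLin.finrank_range_add_finrank_ker
  rw [Module.finrank_fintype_fun_eq_card] at h1
  rw [codeX, Matrix.rank]
  omega

lemma finrank_codeZ [Fintype E] (K : CellComplex V E F) :
    Module.finrank (ZMod 2) K.codeZ = Fintype.card E - K.HZ.rank := by
  have h1 := K.HZ.mulVecLin.finrank_range_add_finrank_ker
  rw [Module.finrank_fintype_fun_eq_card] at h1
  rw [codeZ, Matrix.rank]
  omega

lemma finrank_rowX [Finite V] [Fintype E] (K : CellComplex V E F) :
    Module.finrank (ZMod 2) K.rowX = K.HX.rank :=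
  K.HX.rank_eq_finrank_span_row.symm

lemma finrank_H1 [Fintype E] [Fintype F] (K : CellComplex V E F) (h : K.HX * K.HZᵀ = 0) :
    Module.finrank (ZMod 2) K.H1 = Fintype.card E - K.HX.rank - K.HZ.rank := by
  have hle : LinearMap.range K.HZᵀ.mulVecLin ≤ LinearMap.ker K.HX.mulVecLin := by
    rintro _ ⟨x, rfl⟩
    rw [LinearMap.mem_ker, Matrix.mulVecLin_apply, Matrix.mulVecLin_apply, Matrix.mulVec_mulVec, h,
      Matrix.zero_mulVec]
  have h1 := Submodule.finrank_quotient_add_finrank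
    ((LinearMap.range K.HZᵀ.mulVecLin).submoduleOf (LinearMap.ker K.HX.mulVecLin))
  have h2 := (Submodule.submoduleOfEquivOfLe hle).finrank_eq
  have h3 := K.finrank_codeX
  have h4 := K.HZ.rank_transpose
  rw [Matrix.rank] at h4
  rw [codeX] at h3
  change Module.finrank (ZMod 2) (LinearMap.ker K.HX.mulVecLin ⧸
    (LinearMap.range K.HZᵀ.mulVecLin).submoduleOf (LinearMap.ker K.HX.mulVecLin)) = _
  omega

/-- At an end of an edge in the support of a cycle there is another edge of the support. -/
lemma exists_ne_of_mem_codeX [Fintype E] (K : CellComplex V E F) {x : E → ZMod 2}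
    (hx : x ∈ K.codeX) {v : V} {e : E} (hv : K.endOf v e) (he : x e ≠ 0) :
    ∃ e', e' ≠ e ∧ K.endOf v e' ∧ x e' ≠ 0 := by
  by_contra! hno
  have h0 : (K.HX *ᵥ x) v = 0 := congrFun hx v
  rw [Matrix.mulVec, dotProduct, Finset.sum_eq_single e] at h0
  · simp [HX, hv, he] at h0
  · intro e' _ hne
    by_cases hv' : K.endOf v e'
    · rw [hno e' hne hv', mul_zero]
    · simp [HX, hv']
  · simp

/-- Every vertex met by the support has even degree in it. From an edge uv of the support, continue
by further edges at v and at u; at the far end w of the edge at v there is yet another one.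
Simplicity and the absence of triangles make the four edges distinct. -/
lemma four_le_hammingNorm [Fintype E] (K : CellComplex V E F)
    (h : ∀ e, {v | K.endOf v e}.ncard = 2)
    (hsimple : ∀ e e', (∀ v, K.endOf v e ↔ K.endOf v e') → e = e')
    (htri : ∀ u v w, u ≠ v → v ≠ w → u ≠ w → (∃ e, K.endOf u e ∧ K.endOf v e) →
      (∃ e, K.endOf v e ∧ K.endOf w e) → ¬ ∃ e, K.endOf u e ∧ K.endOf w e)
    {x : E → ZMod 2} (hx : x ∈ K.codeX) (h0 : x ≠ 0) : 4 ≤ hammingNorm x := by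
  classical
  obtain ⟨e, he⟩ := Function.ne_iff.1 h0
  obtain ⟨u, v, huv, hs⟩ := K.exists_ends h e
  obtain ⟨e₂, hne₂, hv₂, hx₂⟩ := K.exists_ne_of_mem_codeX hx ((hs v).2 (Or.inr rfl)) he
  obtain ⟨e₃, hne₃, hu₃, hx₃⟩ := K.exists_ne_of_mem_codeX hx ((hs u).2 (Or.inl rfl)) he
  obtain ⟨w, hwv, hs₂⟩ := K.exists_other_end h hv₂
  have hwu : w ≠ u := by
    rintro rfl
    exact hne₂ (hsimple _ _ fun z => by rw [hs, hs₂, or_comm])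
  have hu₂ : ¬ K.endOf u e₂ := by
    rw [hs₂]
    rintro (h | h)
    · exact huv h
    · exact hwu h.symm
  have hw : K.endOf w e₂ := (hs₂ w).2 (Or.inr rfl)
  obtain ⟨e₄, hne₄, hw₄, hx₄⟩ := K.exists_ne_of_mem_codeX hx hw hx₂
  have h42 : e₃ ≠ e₂ := by
    rintro rfl
    exact hu₂ hu₃
  have h4 : e₄ ≠ e := by
    rintro rfl
    rcases (hs w).1 hw₄ with h | h
    · exact hwu h
    · exact hwv h
  have h43 : e₄ ≠ e₃ := by
    rintro rfl
    exact htri u v w huv hwv.symm hwu.symm ⟨e, (hs u).2 (Or.inl rfl), (hs v).2 (Or.inr rfl)⟩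
      ⟨e₂, hv₂, hw⟩ ⟨e₄, hu₃, hw₄⟩
  have hcard : ({e, e₂, e₃, e₄} : Finset E).card = 4 := by
    rw [Finset.card_insert_of_notMem, Finset.card_insert_of_notMem, Finset.card_pair h43.symm]
    · simp [h42.symm, hne₄.symm]
    · simp [hne₂.symm, hne₃.symm, h4.symm]
  rw [← hcard]
  refine Finset.card_le_card fun z hz => ?_
  simp only [Finset.mem_insert, Finset.mem_singleton] at hz
  simp only [Finset.mem_filter, Finset.mem_univ, true_and]
  rcases hz with rfl | rfl | rfl | rfl
  exacts [he, hx₂, hx₃, hx₄]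

/-! ### Self-dual complexes -/

/-- The axioms on the faces of an edge, the edges at a vertex and the vertex links are the duals of
those on edge ends, sides and face boundaries, so they are transported along the duality. -/
lemma isMap_of_isSelfDual (K : CellComplex V E F) (hd : K.IsSelfDual) (hV : Nonempty V)
    (h : ∀ e, {v | K.endOf v e}.ncard = 2)
    (hsimple : ∀ e e', (∀ v, K.endOf v e ↔ K.endOf v e') → e = e')
    (hcorner : ∀ v f, K.onFace v f → {e | K.endOf v e ∧ K.sideOf e f}.ncard = 2)
    (hside : ∀ f, ∃ e, K.sideOf e f)
    (hface : ∀ f e e', K.sideOf e f → K.sideOf e' f → Relation.ReflTransGen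
      (fun a b => K.sideOf a f ∧ K.sideOf b f ∧ ∃ v, K.endOf v a ∧ K.endOf v b) e e')
    (hc : ∀ v w, Relation.ReflTransGen (fun a b => ∃ e, K.endOf a e ∧ K.endOf b e) v w) :
    K.IsMap where
  nonempty := hV
  edge_ends := h
  simple := hsimple
  corner := hcorner
  side_exists := hside
  face_connected := hface
  connected := hc
  edge_faces e := by
    obtain ⟨α, β, γ, -, h2⟩ := hd
    rw [← h (β e)]
    refine Set.ncard_congr (fun f _ => γ f) (fun f hf => (h2 e f).1 hf)
      (fun _ _ _ _ h => γ.injective h) fun v hv => ⟨γ.symm v, (h2 e _).2 ?_, by simp⟩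
    rw [γ.apply_symm_apply]
    exact hv
  edge_exists v := by
    obtain ⟨α, β, γ, h1, -⟩ := hd
    obtain ⟨e, he⟩ := hside (α v)
    refine ⟨β.symm e, (h1 v _).2 ?_⟩
    rw [β.apply_symm_apply]
    exact he
  link_connected v e e' he he' := by
    obtain ⟨α, β, γ, h1, h2⟩ := hd
    have := hface (α v) (β e) (β e') ((h1 v e).1 he) ((h1 v e').1 he')
    have key := Relation.ReflTransGen.lift (p := fun a b =>
      K.endOf v a ∧ K.endOf v b ∧ ∃ f, K.sideOf a f ∧ K.sideOf b f) β.symm ?_ _ _ this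
    · simpa [Function.onFun] using key
    · rintro a b ⟨ha, hb, w, hwa, hwb⟩
      refine ⟨(h1 v _).2 (by simpa [dual] using ha),
        (h1 v _).2 (by simpa [dual] using hb), γ.symm w, (h2 _ _).2 ?_, (h2 _ _).2 ?_⟩
      · simpa [dual] using hwa
      · simpa [dual] using hwb

/-- Permuting rows and columns preserves rank and weights, so bounds for `HX` pass to `HZ`. -/
lemma exists_HZ_eq_submatrix (K : CellComplex V E F) (hd : K.IsSelfDual) :
    ∃ (β : E ≃ E) (γ : F ≃ V), K.HZ = K.HX.submatrix γ β := by
  obtain ⟨α, β, γ, -, h2⟩ := hd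
  refine ⟨β, γ, ?_⟩
  ext f e
  have : K.sideOf e f ↔ K.endOf (γ f) (β e) := h2 e f
  by_cases h : K.sideOf e f
  · simp [HX, HZ, h, this.1 h]
  · simp [HX, HZ, h, mt this.2 h]

lemma rank_HZ_of_isSelfDual [Fintype E] (K : CellComplex V E F) (hd : K.IsSelfDual) :
    K.HZ.rank = K.HX.rank := by
  obtain ⟨β, γ, h⟩ := K.exists_HZ_eq_submatrix hd
  rw [h, Matrix.rank_submatrix]

lemma le_hammingNorm_of_isSelfDual [Fintype E] (K : CellComplex V E F) (hd : K.IsSelfDual) {d : ℕ}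
    (hX : ∀ x ∈ K.codeX, x ≠ 0 → d ≤ hammingNorm x) {x : E → ZMod 2} (hx : x ∈ K.codeZ)
    (h0 : x ≠ 0) : d ≤ hammingNorm x := by
  classical
  obtain ⟨β, γ, h⟩ := K.exists_HZ_eq_submatrix hd
  have hmem : x ∘ β.symm ∈ K.codeX := by
    change K.HX *ᵥ (x ∘ β.symm) = 0
    have hx' : K.HZ *ᵥ x = 0 := hx
    rw [h, Matrix.submatrix_mulVec_equiv] at hx'
    funext v
    simpa using congrFun hx' (γ.symm v)
  have hnorm : hammingNorm (x ∘ β.symm) = hammingNorm x :=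
    Finset.card_equiv β.symm fun e => by simp
  rw [← hnorm]
  refine hX _ hmem fun h => h0 ?_
  funext e
  simpa using congrFun h (β e)

/-- The homological code of a self-dual map without triangles, from a closed walk of length `4` and
a cocycle that are not orthogonal. -/
lemma isHomologicalCode_of_isSelfDual [Fintype V] [Fintype E] [DecidableEq E] [Fintype F]
    (K : CellComplex V E F) (hK : K.IsMap) (hd : K.IsSelfDual)
    (htri : ∀ u v w, u ≠ v → v ≠ w → u ≠ w → (∃ e, K.endOf u e ∧ K.endOf v e) →
      (∃ e, K.endOf v e ∧ K.endOf w e) → ¬ ∃ e, K.endOf u e ∧ K.endOf w e)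
    {x y : E → ZMod 2} (hx : x ∈ K.codeX) (hy : y ∈ K.codeZ) (hxy : x ⬝ᵥ y ≠ 0)
    (h4 : hammingNorm x = 4) {n k : ℕ} (hn : Fintype.card E = n)
    (hk : n = k + 2 * (Fintype.card V - 1)) : K.IsHomologicalCode n k 4 := by
  have := hK.nonempty
  have horth := K.HX_mul_HZ_transpose hK.corner
  have hX : ∀ x ∈ K.codeX, x ≠ 0 → 4 ≤ hammingNorm x := fun x hx h0 =>
    K.four_le_hammingNorm hK.edge_ends hK.simple htri hx h0
  have hZ : ∀ x ∈ K.codeZ, x ≠ 0 → 4 ≤ hammingNorm x := fun x hx h0 =>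
    K.le_hammingNorm_of_isSelfDual hd hX hx h0
  have hrX := K.rank_HX hK.edge_ends hK.connected
  have hrZ := K.rank_HZ_of_isSelfDual hd
  refine ⟨horth, ⟨K.isStabilizerGroup_stabilizer horth, ?_, ?_,
    K.isLeast_logicalWeights horth hX hZ hx hy hxy h4⟩, ?_,
    K.isLeast_essentialWords hX hZ hx hy hxy h4⟩
  · rw [Nat.card_eq_fintype_card, hn]
  · rw [K.finrank_stabilizerCode horth, K.finrank_codeZ, K.finrank_rowX]
    congr 1
    omega
  · rw [K.finrank_H1 horth]
    omega

/-- Counting the pairs of an edge and a face that has it as a side. -/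
lemma two_mul_card_edges [Fintype E] [Fintype F] (K : CellComplex V E F) (hK : K.IsMap) {p : ℕ}
    (hp : ∀ f, {e | K.sideOf e f}.ncard = p) : 2 * Fintype.card E = p * Fintype.card F := by
  classical
  have h := Finset.sum_card_bipartiteAbove_eq_sum_card_bipartiteBelow (s := Finset.univ)
    (t := Finset.univ) K.sideOf
  have h1 : ∀ e, (Finset.univ.bipartiteAbove K.sideOf e).card = 2 := fun e => by
    rw [← hK.edge_faces e, Set.ncard_eq_toFinset_card']
    congr 1
    ext f
    simp [Finset.bipartiteAbove]
  have h2 : ∀ f, (Finset.univ.bipartiteBelow K.sideOf f).card = p := fun f => by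
    rw [← hp f, Set.ncard_eq_toFinset_card']
    congr 1
    ext f
    simp [Finset.bipartiteBelow]
  simp only [h1, h2, Finset.sum_const, Finset.card_univ, smul_eq_mul] at h
  linarith

end CellComplex

end

/-! ### The offsets of the faces -/

section Offsets

variable (m₁ m₂ : ℕ)

/-- Half the number of vertices. -/
def halfOrder : ℕ := 3 ^ (m₁ - 1) + 2 * m₂ - 1

lemma oddMapOrder_eq : oddMapOrder m₁ m₂ = 2 * halfOrder m₁ m₂ := rfl

/-- The lengths of the edges: the sides `2 t` and `2 t + 1` of a face join vertices at distance
`stepLength t`. -/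
def stepLength (t : ℕ) : ℕ :=
  if t + 2 < m₁ then 3 ^ t else if t + 2 = m₁ then 3 ^ t + m₂ else halfOrder m₁ m₂

lemma faceOffset_even {t : ℕ} (h : 1 ≤ m₁) :
    faceOffset m₁ m₂ (2 * t) = 3 ^ t - 1 + if t + 1 = m₁ then 2 * m₂ else 0 := by
  simp only [faceOffset, offsetSeq]
  rw [if_pos (by omega), if_neg (by omega), Nat.mul_div_cancel_left t (by norm_num), add_zero]
  congr 1
  exact if_congr (by omega) rfl rfl

lemma faceOffset_odd {t : ℕ} (h : 1 ≤ m₁) :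
    faceOffset m₁ m₂ (2 * t + 1) = 2 * 3 ^ t - 1 + if t + 2 = m₁ then m₂ else 0 := by
  simp only [faceOffset, offsetSeq]
  rw [if_neg (by omega), if_neg (c := 2 * t + 1 + 1 = _) (by omega),
    show (2 * t + 1) / 2 = t by omega, add_zero]
  congr 1
  exact if_congr (by omega) rfl rfl

/-- Here and in `faceOffset_even_eq_add`, the corrections m₂ and 2 m₂ in the last two vertices mean
that both sides of type m₁ - 2 grow by m₂. -/
lemma faceOffset_odd_eq_add {t : ℕ} (h : t + 1 < m₁) :
    faceOffset m₁ m₂ (2 * t + 1) = faceOffset m₁ m₂ (2 * t) + stepLength m₁ m₂ t := by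
  rw [faceOffset_odd m₁ m₂ (by omega), faceOffset_even m₁ m₂ (by omega), stepLength]
  have := Nat.one_le_pow t 3 (by norm_num)
  split_ifs <;> omega

lemma faceOffset_even_eq_add {t : ℕ} (h : t + 1 < m₁) :
    faceOffset m₁ m₂ (2 * t + 1 + 1) = faceOffset m₁ m₂ (2 * t + 1) + stepLength m₁ m₂ t := by
  rw [show 2 * t + 1 + 1 = 2 * (t + 1) by ring, faceOffset_odd m₁ m₂ (by omega),
    faceOffset_even m₁ m₂ (by omega), stepLength, pow_succ]
  have := Nat.one_le_pow t 3 (by norm_num)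
  split_ifs <;> omega

variable [hm : Fact (3 ≤ m₁)]

lemma eight_le_halfOrder : 8 ≤ halfOrder m₁ m₂ := by
  have h : 3 ^ 2 ≤ 3 ^ (m₁ - 1) := Nat.pow_le_pow_right (by norm_num) (by have := hm.out; omega)
  unfold halfOrder
  omega

/-- Makes the vertex set a cyclic group, in which all later computations take place. -/
instance : NeZero (oddMapOrder m₁ m₂) :=
  ⟨by have := eight_le_halfOrder m₁ m₂; rw [oddMapOrder_eq]; omega⟩

lemma stepLength_zero : stepLength m₁ m₂ 0 = 1 :=
  if_pos (by have := hm.out; omega)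

lemma stepLength_last : stepLength m₁ m₂ (m₁ - 1) = halfOrder m₁ m₂ := by
  have := hm.out
  rw [stepLength, if_neg (by omega), if_neg (by omega)]

lemma faceOffset_zero : faceOffset m₁ m₂ 0 = 0 := by
  have hm := hm.out
  have h := faceOffset_even m₁ m₂ (t := 0) (by omega)
  rwa [if_neg (by omega)] at h

lemma faceOffset_last : faceOffset m₁ m₂ (2 * (m₁ - 1)) = halfOrder m₁ m₂ := by
  have := hm.out
  rw [faceOffset_even m₁ m₂ (by omega), if_pos (by omega), halfOrder]
  have := Nat.one_le_pow (m₁ - 1) 3 (by norm_num)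
  omega

lemma stepLength_pos (t : ℕ) : 0 < stepLength m₁ m₂ t := by
  have := Nat.one_le_pow t 3 (by norm_num)
  have := eight_le_halfOrder m₁ m₂
  unfold stepLength
  split_ifs <;> omega

/-- Powers of 3 more than double, and the shift m₂ in type m₁ - 2 is matched by 2 m₂ in N. -/
lemma two_mul_stepLength_lt {s t : ℕ} (hst : s < t) (ht : t < m₁) :
    2 * stepLength m₁ m₂ s < stepLength m₁ m₂ t := by
  have hm := hm.out
  have h1 : 3 ^ (s + 1) ≤ 3 ^ t := Nat.pow_le_pow_right (by norm_num) hst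
  have h2 := Nat.one_le_pow s 3 (by norm_num)
  rw [pow_succ] at h1
  rcases Nat.lt_or_ge (t + 1) m₁ with ht' | ht'
  · rw [stepLength, if_pos (by omega), stepLength]
    split_ifs <;> omega
  · obtain rfl : m₁ = t + 1 := by omega
    rw [stepLength.eq_1 _ _ t, if_neg (by omega), if_neg (by omega), stepLength, halfOrder,
      Nat.add_sub_cancel]
    split_ifs with h h'
    · have : 3 ^ (s + 2) ≤ 3 ^ t := Nat.pow_le_pow_right (by norm_num) (by omega)
      rw [pow_succ, pow_succ] at this
      omega
    -- The tight case s = m₁ - 2: the inequality 2 (3^s + m₂) < 3^(s+1) + 2 m₂ - 1 amounts to 3^s >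
    -- 1, which holds because m₁ ≥ 3.
    · have : 3 ^ 1 ≤ 3 ^ s := Nat.pow_le_pow_right (by norm_num) (by omega)
      omega
    · omega

lemma stepLength_le_halfOrder {t : ℕ} (ht : t < m₁) : stepLength m₁ m₂ t ≤ halfOrder m₁ m₂ := by
  rcases Nat.lt_or_ge t (m₁ - 1) with h | h
  · have := two_mul_stepLength_lt m₁ m₂ h (by omega)
    rw [stepLength_last] at this
    omega
  · obtain rfl : t = m₁ - 1 := by omega
    exact (stepLength_last m₁ m₂).le

lemma faceOffset_lt_succ {i : ℕ} (hi : i + 1 < 2 * m₁ - 1) :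
    faceOffset m₁ m₂ i < faceOffset m₁ m₂ (i + 1) := by
  obtain ⟨t, rfl | rfl⟩ : ∃ t, i = 2 * t ∨ i = 2 * t + 1 := ⟨i / 2, by omega⟩
  · rw [faceOffset_odd_eq_add m₁ m₂ (by omega)]
    exact Nat.lt_add_of_pos_right (stepLength_pos m₁ m₂ t)
  · rw [faceOffset_even_eq_add m₁ m₂ (by omega)]
    exact Nat.lt_add_of_pos_right (stepLength_pos m₁ m₂ t)

lemma faceOffset_lt {i j : ℕ} (hij : i < j) (hj : j < 2 * m₁ - 1) :
    faceOffset m₁ m₂ i < faceOffset m₁ m₂ j := by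
  induction j, hij using Nat.le_induction with
  | base => exact faceOffset_lt_succ m₁ m₂ hj
  | succ j _ ih => exact (ih (by omega)).trans (faceOffset_lt_succ m₁ m₂ hj)

lemma faceOffset_lt_order {i : ℕ} (hi : i < 2 * m₁ - 1) :
    faceOffset m₁ m₂ i < oddMapOrder m₁ m₂ := by
  have h := eight_le_halfOrder m₁ m₂
  rw [oddMapOrder_eq]
  rcases Nat.lt_or_ge i (2 * (m₁ - 1)) with h' | h'
  · have := faceOffset_lt m₁ m₂ h' (by omega)
    rw [faceOffset_last] at this
    omega
  · obtain rfl : i = 2 * (m₁ - 1) := by omega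
    rw [faceOffset_last]
    omega

/-! ### Residues -/

/-- The residue of `n` modulo the number of vertices. -/
def residue (n : ℕ) : Fin (oddMapOrder m₁ m₂) := Fin.ofNat _ n

lemma residue_add (a b : ℕ) :
    residue m₁ m₂ (a + b) = residue m₁ m₂ a + residue m₁ m₂ b := by
  ext
  simp [residue, Fin.val_add]

lemma residue_zero : residue m₁ m₂ 0 = 0 := by
  ext
  simp [residue]

lemma residue_val (x : Fin (oddMapOrder m₁ m₂)) : residue m₁ m₂ x.val = x := by
  ext
  simp [residue]

lemma residue_inj {a b : ℕ} (ha : a < oddMapOrder m₁ m₂) (hb : b < oddMapOrder m₁ m₂) :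
    residue m₁ m₂ a = residue m₁ m₂ b ↔ a = b := by
  rw [residue, residue, Fin.ext_iff, Fin.val_ofNat, Fin.val_ofNat, Nat.mod_eq_of_lt ha,
    Nat.mod_eq_of_lt hb]

lemma residue_order : residue m₁ m₂ (oddMapOrder m₁ m₂) = 0 := by
  ext
  simp [residue]

lemma faceVertex_eq (j : Fin (oddMapOrder m₁ m₂)) (i : ℕ) :
    faceVertex m₁ m₂ j i = j + residue m₁ m₂ (faceOffset m₁ m₂ i) := by
  ext
  simp [faceVertex, residue, Fin.val_add]

lemma residue_half_add_half :
    residue m₁ m₂ (halfOrder m₁ m₂) + residue m₁ m₂ (halfOrder m₁ m₂) = 0 := by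
  rw [← residue_add, ← two_mul, ← oddMapOrder_eq, residue_order]

lemma residue_step_ne_zero {t : ℕ} (ht : t < m₁) : residue m₁ m₂ (stepLength m₁ m₂ t) ≠ 0 := by
  have h1 := stepLength_pos m₁ m₂ t
  have h2 := stepLength_le_halfOrder m₁ m₂ ht
  have h3 := oddMapOrder_eq m₁ m₂
  rw [← residue_zero, Ne, residue_inj] <;> omega

lemma stepLength_inj {s t : ℕ} (hs : s < m₁) (ht : t < m₁)
    (h : stepLength m₁ m₂ s = stepLength m₁ m₂ t) : s = t := by
  rcases lt_trichotomy s t with hst | hst | hst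
  · have := two_mul_stepLength_lt m₁ m₂ hst ht
    omega
  · exact hst
  · have := two_mul_stepLength_lt m₁ m₂ hst hs
    omega

lemma eq_of_residue_step_eq {s t : ℕ} (hs : s < m₁) (ht : t < m₁)
    (h : residue m₁ m₂ (stepLength m₁ m₂ s) = residue m₁ m₂ (stepLength m₁ m₂ t)) : s = t := by
  have h1 := stepLength_pos m₁ m₂ t
  have h2 := stepLength_le_halfOrder m₁ m₂ ht
  have h2' := stepLength_le_halfOrder m₁ m₂ hs
  have h3 := oddMapOrder_eq m₁ m₂
  exact stepLength_inj m₁ m₂ hs ht ((residue_inj m₁ m₂ (by omega) (by omega)).1 h)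

/-- Two positive lengths of at most N can sum to a multiple of 2N only if both are N. -/
lemma eq_last_of_residue_step_add {s t : ℕ} (hs : s < m₁) (ht : t < m₁)
    (h : residue m₁ m₂ (stepLength m₁ m₂ s) + residue m₁ m₂ (stepLength m₁ m₂ t) = 0) :
    s = m₁ - 1 ∧ t = m₁ - 1 := by
  have h1 := stepLength_pos m₁ m₂ t
  have h1' := stepLength_pos m₁ m₂ s
  have h2 := stepLength_le_halfOrder m₁ m₂ ht
  have h2' := stepLength_le_halfOrder m₁ m₂ hs
  have h3 := oddMapOrder_eq m₁ m₂
  rw [← residue_add] at h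
  by_cases hlt : stepLength m₁ m₂ s + stepLength m₁ m₂ t < oddMapOrder m₁ m₂
  · rw [← residue_zero, residue_inj m₁ m₂ hlt (by omega)] at h
    omega
  · constructor
    · apply stepLength_inj m₁ m₂ hs (by omega)
      rw [stepLength_last]
      omega
    · apply stepLength_inj m₁ m₂ ht (by omega)
      rw [stepLength_last]
      omega

/-- Unless the sum is 2N, this is a relation between integers. If a and b are both below c, the sum
is too small by the doubling property; otherwise one summand alone is at least s_c and the other is
positive. -/
lemma residue_step_add_ne {a b c : ℕ} (ha : a < m₁) (hb : b < m₁) (hc : c < m₁) :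
    residue m₁ m₂ (stepLength m₁ m₂ a) + residue m₁ m₂ (stepLength m₁ m₂ b) ≠
      residue m₁ m₂ (stepLength m₁ m₂ c) := by
  intro h
  have h3 := oddMapOrder_eq m₁ m₂
  have pa := stepLength_pos m₁ m₂ a
  have pb := stepLength_pos m₁ m₂ b
  have la := stepLength_le_halfOrder m₁ m₂ ha
  have lb := stepLength_le_halfOrder m₁ m₂ hb
  have lc := stepLength_le_halfOrder m₁ m₂ hc
  have hle : ∀ s, s < m₁ → c ≤ s → stepLength m₁ m₂ c ≤ stepLength m₁ m₂ s := by
    intro s hs hcs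
    rcases hcs.lt_or_eq with h | rfl
    · have := two_mul_stepLength_lt m₁ m₂ h hs
      omega
    · rfl
  by_cases hlt : stepLength m₁ m₂ a + stepLength m₁ m₂ b < oddMapOrder m₁ m₂
  · rw [← residue_add, residue_inj m₁ m₂ hlt (by omega)] at h
    rcases Nat.lt_or_ge a c with hac | hac
    · have := two_mul_stepLength_lt m₁ m₂ hac hc
      rcases Nat.lt_or_ge b c with hbc | hbc
      · have := two_mul_stepLength_lt m₁ m₂ hbc hc
        omega
      · have := hle b hb hbc
        omega
    · have := hle a ha hac
      omega
  · rw [← residue_add, show stepLength m₁ m₂ a + stepLength m₁ m₂ b = oddMapOrder m₁ m₂ by omega,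
      residue_order] at h
    exact residue_step_ne_zero m₁ m₂ hc h.symm

lemma residue_step_add_add_ne {a b c : ℕ} (ha : a < m₁) (hb : b < m₁) (hc : c < m₁) :
    residue m₁ m₂ (stepLength m₁ m₂ a) + residue m₁ m₂ (stepLength m₁ m₂ b) +
      residue m₁ m₂ (stepLength m₁ m₂ c) ≠ 0 := by
  intro h
  have hneg : ∀ s, s < m₁ → s = m₁ - 1 ∨ 2 * stepLength m₁ m₂ s < halfOrder m₁ m₂ := by
    intro s hs
    rcases Nat.lt_or_ge s (m₁ - 1) with h | h
    · right
      have := two_mul_stepLength_lt m₁ m₂ h (by omega)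
      rwa [stepLength_last] at this
    · left
      omega
  have key : ∀ t, residue m₁ m₂ (stepLength m₁ m₂ t) = residue m₁ m₂ (halfOrder m₁ m₂) →
      -residue m₁ m₂ (stepLength m₁ m₂ t) = residue m₁ m₂ (stepLength m₁ m₂ t) := by
    intro t ht
    rw [ht, neg_eq_iff_add_eq_zero, residue_half_add_half]
  have hlast := congrArg (residue m₁ m₂) (stepLength_last m₁ m₂)
  -- If some length is N, it is its own negative modulo 2N and moves to the other side, reducing to
  -- `residue_step_add_ne`. Otherwise all three are below N/2 and their sum lies strictly between 0
  -- and 2N.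
  rcases hneg a ha with rfl | h1
  · refine residue_step_add_ne m₁ m₂ hb hc ha ?_
    rw [← key _ hlast]
    exact eq_neg_of_add_eq_zero_right (by rw [← h]; abel)
  rcases hneg b hb with rfl | h2
  · refine residue_step_add_ne m₁ m₂ ha hc hb ?_
    rw [← key _ hlast]
    exact eq_neg_of_add_eq_zero_right (by rw [← h]; abel)
  rcases hneg c hc with rfl | h3
  · refine residue_step_add_ne m₁ m₂ ha hb hc ?_
    rw [← key _ hlast]
    exact eq_neg_of_add_eq_zero_left h
  have h4 := oddMapOrder_eq m₁ m₂
  have := stepLength_pos m₁ m₂ a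
  rw [← residue_add, ← residue_add, ← residue_zero, residue_inj] at h <;> omega

end Offsets

section OddMap

variable (m₁ m₂ : ℕ) [hm : Fact (3 ≤ m₁)]

/-! ### The edges of the map -/

/-- The residue of the length of the edges of type `t`. -/
def stepRes (t : ℕ) : Fin (oddMapOrder m₁ m₂) := residue m₁ m₂ (stepLength m₁ m₂ t)

/-- The residue of the offset of the vertex number `i` of a face. -/
def offsetRes (i : ℕ) : Fin (oddMapOrder m₁ m₂) := residue m₁ m₂ (faceOffset m₁ m₂ i)

lemma stepRes_last_add : stepRes m₁ m₂ (m₁ - 1) + stepRes m₁ m₂ (m₁ - 1) = 0 := by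
  rw [stepRes, stepLength_last, residue_half_add_half]

lemma offsetRes_last : offsetRes m₁ m₂ (2 * (m₁ - 1)) = stepRes m₁ m₂ (m₁ - 1) := by
  rw [offsetRes, faceOffset_last, stepRes, stepLength_last]

lemma offsetRes_zero : offsetRes m₁ m₂ 0 = 0 := by
  rw [offsetRes, faceOffset_zero, residue_zero]

lemma offsetRes_odd {t : ℕ} (h : t + 1 < m₁) :
    offsetRes m₁ m₂ (2 * t + 1) = offsetRes m₁ m₂ (2 * t) + stepRes m₁ m₂ t := by
  rw [offsetRes, faceOffset_odd_eq_add m₁ m₂ h, residue_add]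
  rfl

/-- The closing side fits the pattern because it leads from N back to 0, and N + N = 0. -/
lemma offsetRes_succ_mod {i : ℕ} (hi : i < 2 * m₁ - 1) :
    offsetRes m₁ m₂ ((i + 1) % (2 * m₁ - 1)) = offsetRes m₁ m₂ i + stepRes m₁ m₂ (i / 2) := by
  obtain ⟨t, rfl | rfl⟩ : ∃ t, i = 2 * t ∨ i = 2 * t + 1 := ⟨i / 2, by omega⟩
  · rw [Nat.mul_div_cancel_left t (by norm_num)]
    rcases Nat.lt_or_ge (t + 1) m₁ with h | h
    · rw [Nat.mod_eq_of_lt (by omega), offsetRes_odd m₁ m₂ h]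
    · obtain rfl : t = m₁ - 1 := by omega
      rw [show 2 * (m₁ - 1) + 1 = 2 * m₁ - 1 by omega, Nat.mod_self, offsetRes_zero,
        offsetRes_last, stepRes_last_add]
  · rw [Nat.mod_eq_of_lt (by omega), show (2 * t + 1) / 2 = t by omega, offsetRes,
      faceOffset_even_eq_add m₁ m₂ (by omega), residue_add]
    rfl

lemma offsetRes_inj {i j : ℕ} (hi : i < 2 * m₁ - 1) (hj : j < 2 * m₁ - 1)
    (h : offsetRes m₁ m₂ i = offsetRes m₁ m₂ j) : i = j := by
  have h' := (residue_inj m₁ m₂ (faceOffset_lt_order m₁ m₂ hi)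
    (faceOffset_lt_order m₁ m₂ hj)).1 h
  rcases lt_trichotomy i j with hij | hij | hij
  · have := faceOffset_lt m₁ m₂ hij hj
    omega
  · exact hij
  · have := faceOffset_lt m₁ m₂ hij hi
    omega

/-- The pair `{x, x + stepRes t}`. -/
def stepPair (t : ℕ) (x : Fin (oddMapOrder m₁ m₂)) : Sym2 (Fin (oddMapOrder m₁ m₂)) :=
  s(x, x + stepRes m₁ m₂ t)

lemma faceSide_eq (j : Fin (oddMapOrder m₁ m₂)) (i : Fin (2 * m₁ - 1)) :
    faceSide m₁ m₂ j i = stepPair m₁ m₂ (i.val / 2) (j + offsetRes m₁ m₂ i.val) := by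
  rw [faceSide, faceVertex_eq, faceVertex_eq, stepPair]
  change s(j + offsetRes m₁ m₂ i.val, j + offsetRes m₁ m₂ _) = _
  rw [offsetRes_succ_mod m₁ m₂ i.isLt, add_assoc]

lemma stepPair_last_add (x : Fin (oddMapOrder m₁ m₂)) :
    stepPair m₁ m₂ (m₁ - 1) (x + stepRes m₁ m₂ (m₁ - 1)) = stepPair m₁ m₂ (m₁ - 1) x := by
  rw [stepPair, add_assoc, stepRes_last_add, add_zero, Sym2.eq_swap, stepPair]

/-- An edge determines its type and its starting point, except that a diameter {x, x + N} may start
at either end. -/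
lemma stepPair_inj {s t : ℕ} (hs : s < m₁) (ht : t < m₁) {x y : Fin (oddMapOrder m₁ m₂)}
    (h : stepPair m₁ m₂ s x = stepPair m₁ m₂ t y) :
    s = t ∧ (x = y ∨ (t = m₁ - 1 ∧ x = y + stepRes m₁ m₂ t)) := by
  rw [stepPair, stepPair, Sym2.eq_iff] at h
  rcases h with ⟨rfl, h⟩ | ⟨rfl, h⟩
  · exact ⟨eq_of_residue_step_eq m₁ m₂ hs ht (add_left_cancel h), Or.inl rfl⟩
  · rw [add_assoc, add_eq_left] at h
    obtain ⟨rfl, rfl⟩ := eq_last_of_residue_step_add m₁ m₂ ht hs h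
    exact ⟨rfl, Or.inr ⟨rfl, rfl⟩⟩

/-- For t < m₁ - 1 the two alternatives are the sides 2t and 2t + 1 of the face. For t = m₁ - 1
there is only the closing side, and the alternatives are its two possible starting points. -/
lemma exists_faceSide_eq_stepPair {t : ℕ} (ht : t < m₁) (x j : Fin (oddMapOrder m₁ m₂)) :
    (∃ i, stepPair m₁ m₂ t x = faceSide m₁ m₂ j i) ↔
      x = j + offsetRes m₁ m₂ (2 * t) ∨
        x = j + offsetRes m₁ m₂ (2 * t) + stepRes m₁ m₂ t := by
  constructor
  · rintro ⟨⟨i, hi⟩, hside⟩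
    rw [faceSide_eq] at hside
    obtain ⟨rfl, h⟩ := stepPair_inj m₁ m₂ ht (by dsimp only; omega) hside
    clear hside
    dsimp only at h
    obtain ⟨t, rfl | rfl⟩ : ∃ t, i = 2 * t ∨ i = 2 * t + 1 := ⟨i / 2, by omega⟩
    · rw [Nat.mul_div_cancel_left t (by norm_num)] at h ⊢
      rcases h with rfl | ⟨-, rfl⟩
      · exact Or.inl rfl
      · exact Or.inr rfl
    · rw [show (2 * t + 1) / 2 = t by omega] at h ⊢
      rcases h with rfl | ⟨h, -⟩
      · right
        rw [offsetRes_odd m₁ m₂ (by omega), add_assoc]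
      · omega
  · rintro (rfl | rfl)
    · refine ⟨⟨2 * t, by omega⟩, ?_⟩
      rw [faceSide_eq, Nat.mul_div_cancel_left t (by norm_num)]
    · rcases Nat.lt_or_ge (t + 1) m₁ with h | h
      · refine ⟨⟨2 * t + 1, by omega⟩, ?_⟩
        rw [faceSide_eq]
        dsimp only
        rw [show (2 * t + 1) / 2 = t by omega, offsetRes_odd m₁ m₂ h, add_assoc]
      · obtain rfl : t = m₁ - 1 := by omega
        refine ⟨⟨2 * (m₁ - 1), by omega⟩, ?_⟩
        rw [faceSide_eq, Nat.mul_div_cancel_left _ (by norm_num), stepPair_last_add]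

lemma stepPair_mem {t : ℕ} (ht : t < m₁) (x : Fin (oddMapOrder m₁ m₂)) :
    stepPair m₁ m₂ t x ∈ oddMapEdges m₁ m₂ := by
  obtain ⟨i, hi⟩ := (exists_faceSide_eq_stepPair m₁ m₂ ht x (x - offsetRes m₁ m₂ (2 * t))).2
    (Or.inl (sub_add_cancel _ _).symm)
  exact Finset.mem_image.2 ⟨(_, i), Finset.mem_univ _, hi.symm⟩

/-- The edge with the ends `x` and `x + stepRes t`. -/
def stepEdge {t : ℕ} (ht : t < m₁) (x : Fin (oddMapOrder m₁ m₂)) : oddMapEdges m₁ m₂ :=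
  ⟨stepPair m₁ m₂ t x, stepPair_mem m₁ m₂ ht x⟩

lemma exists_eq_stepEdge (e : oddMapEdges m₁ m₂) :
    ∃ (t : ℕ) (ht : t < m₁) (x : Fin (oddMapOrder m₁ m₂)), e = stepEdge m₁ m₂ ht x := by
  obtain ⟨e, he⟩ := e
  obtain ⟨⟨j, i⟩, -, rfl⟩ := Finset.mem_image.1 he
  exact ⟨i.val / 2, by omega, _, Subtype.ext (faceSide_eq m₁ m₂ j i)⟩

lemma endOf_stepEdge {t : ℕ} (ht : t < m₁) (x v : Fin (oddMapOrder m₁ m₂)) :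
    (oddMap m₁ m₂).endOf v (stepEdge m₁ m₂ ht x) ↔ v = x ∨ v = x + stepRes m₁ m₂ t :=
  Sym2.mem_iff

lemma sideOf_stepEdge {t : ℕ} (ht : t < m₁) (x f : Fin (oddMapOrder m₁ m₂)) :
    (oddMap m₁ m₂).sideOf (stepEdge m₁ m₂ ht x) f ↔ x = f + offsetRes m₁ m₂ (2 * t) ∨
      x = f + offsetRes m₁ m₂ (2 * t) + stepRes m₁ m₂ t :=
  exists_faceSide_eq_stepPair m₁ m₂ ht x f

lemma self_ne_add_stepRes {t : ℕ} (ht : t < m₁) (x : Fin (oddMapOrder m₁ m₂)) :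
    x ≠ x + stepRes m₁ m₂ t :=
  (add_ne_left.2 (residue_step_ne_zero m₁ m₂ ht)).symm

lemma oddMap_edge_ends (e : oddMapEdges m₁ m₂) : {v | (oddMap m₁ m₂).endOf v e}.ncard = 2 := by
  obtain ⟨t, ht, x, rfl⟩ := exists_eq_stepEdge m₁ m₂ e
  rw [Set.ncard_eq_two]
  exact ⟨x, _, self_ne_add_stepRes m₁ m₂ ht x, Set.ext fun v => endOf_stepEdge m₁ m₂ ht x v⟩

omit hm in
lemma oddMap_simple (e e' : oddMapEdges m₁ m₂)
    (h : ∀ v, (oddMap m₁ m₂).endOf v e ↔ (oddMap m₁ m₂).endOf v e') : e = e' :=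
  Subtype.ext (Sym2.ext h)

lemma oddMap_isSelfDual : (oddMap m₁ m₂).IsSelfDual := by
  have hex : ∀ e, ∃ e', (∀ v, (oddMap m₁ m₂).endOf v e ↔ (oddMap m₁ m₂).sideOf e' (-v)) ∧
      ∀ f, (oddMap m₁ m₂).sideOf e f ↔ (oddMap m₁ m₂).endOf (-f) e' := by
    intro e
    obtain ⟨t, ht, x, rfl⟩ := exists_eq_stepEdge m₁ m₂ e
    -- The edge at y = o_{2t} - x lies on the faces -x and -x - s_t, the negatives of the ends of
    -- the edge at x.
    refine ⟨stepEdge m₁ m₂ ht (offsetRes m₁ m₂ (2 * t) - x), fun v => ?_, fun f => ?_⟩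
    · rw [endOf_stepEdge, sideOf_stepEdge]
      refine or_congr ?_ ?_ <;> rw [← sub_eq_zero, ← sub_eq_zero (b := _ + _)]
      · rw [show offsetRes m₁ m₂ (2 * t) - x - (-v + offsetRes m₁ m₂ (2 * t)) = v - x by abel]
      · rw [show offsetRes m₁ m₂ (2 * t) - x - (-v + offsetRes m₁ m₂ (2 * t) + stepRes m₁ m₂ t) =
          v - (x + stepRes m₁ m₂ t) by abel, sub_eq_zero]
    · rw [endOf_stepEdge, sideOf_stepEdge]
      refine or_congr ?_ ?_ <;> rw [← sub_eq_zero, ← sub_eq_zero (a := -f)]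
      · rw [show -f - (offsetRes m₁ m₂ (2 * t) - x) = x - (f + offsetRes m₁ m₂ (2 * t)) by abel]
      · rw [show x - (f + offsetRes m₁ m₂ (2 * t) + stepRes m₁ m₂ t) =
          -f - (offsetRes m₁ m₂ (2 * t) - x + stepRes m₁ m₂ t) by abel]
  choose β h1 h2 using hex
  -- The sides of β e determine the ends of e, hence e itself by simplicity; finiteness then gives
  -- bijectivity.
  have hβ : Function.Injective β := fun e e' h => oddMap_simple m₁ m₂ e e' fun v => by
    rw [h1, h1, h]
  exact ⟨Equiv.neg _, Equiv.ofBijective β (Finite.injective_iff_bijective.1 hβ), Equiv.neg _,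
    fun v e => h1 e v, fun e f => h2 e f⟩

/-! ### The faces of the map -/

instance : NeZero (2 * m₁ - 1) := ⟨by have := hm.out; omega⟩

/-- The vertex number `i` of the face `f`. -/
def corner (f : Fin (oddMapOrder m₁ m₂)) (i : Fin (2 * m₁ - 1)) : Fin (oddMapOrder m₁ m₂) :=
  f + offsetRes m₁ m₂ i.val

omit hm in
lemma faceSide_mem (f : Fin (oddMapOrder m₁ m₂)) (i : Fin (2 * m₁ - 1)) :
    faceSide m₁ m₂ f i ∈ oddMapEdges m₁ m₂ :=
  Finset.mem_image.2 ⟨(f, i), Finset.mem_univ _, rfl⟩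

/-- The side number `i` of the face `f`. -/
def sideEdge (f : Fin (oddMapOrder m₁ m₂)) (i : Fin (2 * m₁ - 1)) : oddMapEdges m₁ m₂ :=
  ⟨faceSide m₁ m₂ f i, faceSide_mem m₁ m₂ f i⟩

omit hm in
lemma sideOf_iff (e : oddMapEdges m₁ m₂) (f : Fin (oddMapOrder m₁ m₂)) :
    (oddMap m₁ m₂).sideOf e f ↔ ∃ i, e = sideEdge m₁ m₂ f i :=
  exists_congr fun i => (Subtype.ext_iff (a1 := e) (a2 := sideEdge m₁ m₂ f i)).symm

lemma faceSide_eq_corner (f : Fin (oddMapOrder m₁ m₂)) (i : Fin (2 * m₁ - 1)) :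
    faceSide m₁ m₂ f i = s(corner m₁ m₂ f i, corner m₁ m₂ f (i + 1)) := by
  rw [faceSide, faceVertex_eq, faceVertex_eq, corner, corner, Fin.val_add, Fin.val_one',
    Nat.add_mod_mod]
  rfl

lemma corner_injective (f : Fin (oddMapOrder m₁ m₂)) : Function.Injective (corner m₁ m₂ f) :=
  fun i j h => Fin.ext (offsetRes_inj m₁ m₂ i.isLt j.isLt (add_left_cancel h))

lemma endOf_sideEdge (f v : Fin (oddMapOrder m₁ m₂)) (i : Fin (2 * m₁ - 1)) :
    (oddMap m₁ m₂).endOf v (sideEdge m₁ m₂ f i) ↔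
      v = corner m₁ m₂ f i ∨ v = corner m₁ m₂ f (i + 1) := by
  change v ∈ faceSide m₁ m₂ f i ↔ _
  rw [faceSide_eq_corner, Sym2.mem_iff]

lemma sideEdge_injective (f : Fin (oddMapOrder m₁ m₂)) :
    Function.Injective (sideEdge m₁ m₂ f) := by
  intro i j h
  have h' := congrArg Subtype.val h
  change faceSide m₁ m₂ f i = faceSide m₁ m₂ f j at h'
  rw [faceSide_eq_corner, faceSide_eq_corner, Sym2.eq_iff] at h'
  rcases h' with ⟨h1, -⟩ | ⟨h1, h2⟩
  · exact corner_injective m₁ m₂ f h1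
  · exfalso
    have h1 := corner_injective m₁ m₂ f h1
    have h2 := corner_injective m₁ m₂ f h2
    rw [h1, add_assoc, add_eq_left] at h2
    have h3 := congrArg Fin.val h2
    have := hm.out
    rw [Fin.val_add, Fin.val_one', Fin.val_zero, Nat.mod_eq_of_lt (a := 1) (by omega),
      Nat.mod_eq_of_lt (by omega)] at h3
    omega

lemma onFace_iff (v f : Fin (oddMapOrder m₁ m₂)) :
    (oddMap m₁ m₂).onFace v f ↔ ∃ i, v = corner m₁ m₂ f i := by
  constructor
  · rintro ⟨e, hv, he⟩
    obtain ⟨i, rfl⟩ := (sideOf_iff m₁ m₂ e f).1 he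
    rcases (endOf_sideEdge m₁ m₂ f v i).1 hv with h | h
    exacts [⟨_, h⟩, ⟨_, h⟩]
  · rintro ⟨i, rfl⟩
    exact ⟨sideEdge m₁ m₂ f i, (endOf_sideEdge m₁ m₂ _ _ _).2 (Or.inl rfl),
      (sideOf_iff m₁ m₂ _ _).2 ⟨i, rfl⟩⟩

lemma oddMap_corner (v f : Fin (oddMapOrder m₁ m₂)) (h : (oddMap m₁ m₂).onFace v f) :
    {e | (oddMap m₁ m₂).endOf v e ∧ (oddMap m₁ m₂).sideOf e f}.ncard = 2 := by
  obtain ⟨k, rfl⟩ := (onFace_iff m₁ m₂ v f).1 h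
  have hm := hm.out
  rw [Set.ncard_eq_two]
  refine ⟨sideEdge m₁ m₂ f k, sideEdge m₁ m₂ f (k - 1), fun h => ?_, Set.ext fun e => ?_⟩
  · have h1 := sideEdge_injective m₁ m₂ f h
    rw [eq_sub_iff_add_eq, add_eq_left] at h1
    have h2 := congrArg Fin.val h1
    rw [Fin.val_one', Fin.val_zero, Nat.mod_eq_of_lt (by omega)] at h2
    omega
  · constructor
    · rintro ⟨hv, he⟩
      obtain ⟨i, rfl⟩ := (sideOf_iff m₁ m₂ e f).1 he
      rcases (endOf_sideEdge m₁ m₂ f _ i).1 hv with h | h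
      · obtain rfl := corner_injective m₁ m₂ f h
        exact Or.inl rfl
      · obtain rfl := corner_injective m₁ m₂ f h
        right
        rw [add_sub_cancel_right]
        rfl
    · rintro (rfl | rfl)
      · exact ⟨(endOf_sideEdge m₁ m₂ _ _ _).2 (Or.inl rfl), (sideOf_iff m₁ m₂ _ _).2 ⟨_, rfl⟩⟩
      · exact ⟨(endOf_sideEdge m₁ m₂ _ _ _).2 (Or.inr (by rw [sub_add_cancel])),
          (sideOf_iff m₁ m₂ _ _).2 ⟨_, rfl⟩⟩

lemma oddMap_face_connected (f : Fin (oddMapOrder m₁ m₂)) (e e' : oddMapEdges m₁ m₂)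
    (he : (oddMap m₁ m₂).sideOf e f) (he' : (oddMap m₁ m₂).sideOf e' f) :
    Relation.ReflTransGen (fun a b => (oddMap m₁ m₂).sideOf a f ∧ (oddMap m₁ m₂).sideOf b f ∧
      ∃ v, (oddMap m₁ m₂).endOf v a ∧ (oddMap m₁ m₂).endOf v b) e e' := by
  set R := fun a b => (oddMap m₁ m₂).sideOf a f ∧ (oddMap m₁ m₂).sideOf b f ∧
    ∃ v, (oddMap m₁ m₂).endOf v a ∧ (oddMap m₁ m₂).endOf v b
  have hsymm : ∀ a b, Relation.ReflTransGen R a b → Relation.ReflTransGen R b a := by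
    intro a b h
    induction h with
    | refl => exact Relation.ReflTransGen.refl
    | tail _ h ih =>
      obtain ⟨h1, h2, v, h3, h4⟩ := h
      exact Relation.ReflTransGen.head ⟨h2, h1, v, h4, h3⟩ ih
  have hreach : ∀ n (hn : n < 2 * m₁ - 1),
      Relation.ReflTransGen R (sideEdge m₁ m₂ f 0) (sideEdge m₁ m₂ f ⟨n, hn⟩) := by
    intro n
    induction n with
    | zero => exact fun _ => Relation.ReflTransGen.refl
    | succ n ih =>
      intro hn
      refine (ih (by omega)).tail ⟨(sideOf_iff m₁ m₂ _ _).2 ⟨_, rfl⟩,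
        (sideOf_iff m₁ m₂ _ _).2 ⟨_, rfl⟩, corner m₁ m₂ f ⟨n + 1, hn⟩,
        (endOf_sideEdge m₁ m₂ _ _ _).2 (Or.inr ?_), (endOf_sideEdge m₁ m₂ _ _ _).2 (Or.inl rfl)⟩
      congr 1
      ext
      rw [Fin.val_add, Fin.val_one', Nat.add_mod_mod, Nat.mod_eq_of_lt hn]
  obtain ⟨i, rfl⟩ := (sideOf_iff m₁ m₂ e f).1 he
  obtain ⟨j, rfl⟩ := (sideOf_iff m₁ m₂ e' f).1 he'
  exact (hsymm _ _ (hreach i.val i.isLt)).trans (hreach j.val j.isLt)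

/-- Since s_0 = 1, the edges of type 0 already join consecutive residues. -/
lemma oddMap_connected (v w : Fin (oddMapOrder m₁ m₂)) :
    Relation.ReflTransGen (fun a b => ∃ e, (oddMap m₁ m₂).endOf a e ∧ (oddMap m₁ m₂).endOf b e)
      v w := by
  set R := fun a b => ∃ e, (oddMap m₁ m₂).endOf a e ∧ (oddMap m₁ m₂).endOf b e
  have hpos : 0 < m₁ := by
    have := hm.out
    omega
  have hsymm : ∀ a b, Relation.ReflTransGen R a b → Relation.ReflTransGen R b a := by
    intro a b h
    induction h with
    | refl => exact Relation.ReflTransGen.refl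
    | tail _ h ih =>
      obtain ⟨e, h1, h2⟩ := h
      exact Relation.ReflTransGen.head ⟨e, h2, h1⟩ ih
  have hreach : ∀ n, Relation.ReflTransGen R (residue m₁ m₂ 0) (residue m₁ m₂ n) := by
    intro n
    induction n with
    | zero => exact Relation.ReflTransGen.refl
    | succ n ih =>
      refine ih.tail ⟨stepEdge m₁ m₂ hpos (residue m₁ m₂ n),
        (endOf_stepEdge m₁ m₂ _ _ _).2 (Or.inl rfl), (endOf_stepEdge m₁ m₂ _ _ _).2 (Or.inr ?_)⟩
      rw [residue_add, stepRes, stepLength_zero]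
  have hv := hreach v.val
  have hw := hreach w.val
  rw [residue_val] at hv hw
  exact (hsymm _ _ hv).trans hw

lemma oddMap_isMap : (oddMap m₁ m₂).IsMap :=
  (oddMap m₁ m₂).isMap_of_isSelfDual (oddMap_isSelfDual m₁ m₂) ⟨0⟩ (oddMap_edge_ends m₁ m₂)
    (oddMap_simple m₁ m₂) (oddMap_corner m₁ m₂)
    (fun f => ⟨sideEdge m₁ m₂ f 0, (sideOf_iff m₁ m₂ _ _).2 ⟨0, rfl⟩⟩)
    (oddMap_face_connected m₁ m₂) (oddMap_connected m₁ m₂)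

lemma oddMap_isEquivelar : (oddMap m₁ m₂).IsEquivelar (2 * m₁ - 1) (2 * m₁ - 1) := by
  have hcard : ∀ {α : Type} (g : Fin (2 * m₁ - 1) → α), Function.Injective g →
      (Set.range g).ncard = 2 * m₁ - 1 := fun g hg => by
    rw [← Set.image_univ, Set.ncard_image_of_injective _ hg, Set.ncard_univ, Nat.card_fin]
  constructor
  · intro f
    rw [← hcard _ (sideEdge_injective m₁ m₂ f)]
    congr 1
    ext e
    exact (sideOf_iff m₁ m₂ e f).trans (exists_congr fun _ => eq_comm)
  · intro v
    -- The faces at v are v - o_i, distinct because the offsets are.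
    rw [← hcard (fun i => v - offsetRes m₁ m₂ i.val) fun i j h =>
      Fin.ext (offsetRes_inj m₁ m₂ i.isLt j.isLt (sub_right_injective h))]
    congr 1
    ext f
    refine (onFace_iff m₁ m₂ v f).trans (exists_congr fun i => ?_)
    rw [corner, eq_comm (b := f), eq_sub_iff_add_eq, eq_comm]

lemma oddMap_no_triangle (u v w : Fin (oddMapOrder m₁ m₂)) (huv : u ≠ v) (hvw : v ≠ w)
    (huw : u ≠ w) (h1 : ∃ e, (oddMap m₁ m₂).endOf u e ∧ (oddMap m₁ m₂).endOf v e)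
    (h2 : ∃ e, (oddMap m₁ m₂).endOf v e ∧ (oddMap m₁ m₂).endOf w e) :
    ¬ ∃ e, (oddMap m₁ m₂).endOf u e ∧ (oddMap m₁ m₂).endOf w e := by
  have hadj : ∀ a b : Fin (oddMapOrder m₁ m₂), a ≠ b →
      (∃ e, (oddMap m₁ m₂).endOf a e ∧ (oddMap m₁ m₂).endOf b e) →
      ∃ t, t < m₁ ∧ (b = a + stepRes m₁ m₂ t ∨ a = b + stepRes m₁ m₂ t) := by
    rintro a b hab ⟨e, ha, hb⟩
    obtain ⟨t, ht, x, rfl⟩ := exists_eq_stepEdge m₁ m₂ e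
    rw [endOf_stepEdge] at ha hb
    refine ⟨t, ht, ?_⟩
    rcases ha with rfl | rfl <;> rcases hb with rfl | rfl <;> simp_all
  intro h3
  obtain ⟨a, ha, h1⟩ := hadj u v huv h1
  obtain ⟨b, hb, h2⟩ := hadj v w hvw h2
  obtain ⟨c, hc, h3⟩ := hadj u w huw h3
  have n1 := residue_step_add_add_ne m₁ m₂ ha hb hc
  have n2 := residue_step_add_ne m₁ m₂ ha hb hc
  have n3 := residue_step_add_ne m₁ m₂ ha hc hb
  have n4 := residue_step_add_ne m₁ m₂ hb hc ha
  change stepRes m₁ m₂ a + stepRes m₁ m₂ b + stepRes m₁ m₂ c ≠ 0 at n1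
  change stepRes m₁ m₂ a + stepRes m₁ m₂ b ≠ stepRes m₁ m₂ c at n2
  change stepRes m₁ m₂ a + stepRes m₁ m₂ c ≠ stepRes m₁ m₂ b at n3
  change stepRes m₁ m₂ b + stepRes m₁ m₂ c ≠ stepRes m₁ m₂ a at n4
  generalize stepRes m₁ m₂ a = A at *
  generalize stepRes m₁ m₂ b = B at *
  generalize stepRes m₁ m₂ c = C at *
  have hA : A = v - u ∨ A = u - v := h1.imp (fun h => by rw [h]; abel) fun h => by rw [h]; abel
  have hB : B = w - v ∨ B = v - w := h2.imp (fun h => by rw [h]; abel) fun h => by rw [h]; abel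
  have hC : C = w - u ∨ C = u - w := h3.imp (fun h => by rw [h]; abel) fun h => by rw [h]; abel
  -- Each of the eight orientations of the triangle is one of the four forbidden relations among A,
  -- B, C, up to a global sign.
  rcases hA with rfl | rfl <;> rcases hB with rfl | rfl <;> rcases hC with rfl | rfl <;>
    first
      | (refine n1 ?_; abel1)
      | (refine n2 ?_; abel1)
      | (refine n3 ?_; abel1)
      | (refine n4 ?_; abel1)

end OddMap

/-! ### Boundary and coboundary of a single edge. -/

namespace CellComplex

variable {V E F : Type} [Fintype E] [DecidableEq E]

lemma HX_mulVec_single [DecidableEq V] (K : CellComplex V E F) {e : E} {u v : V} (huv : u ≠ v)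
    (hs : ∀ w, K.endOf w e ↔ w = u ∨ w = v) :
    K.HX *ᵥ Pi.single e 1 = Pi.single u 1 + Pi.single v 1 := by
  ext w
  rw [Matrix.mulVec_single_one, Matrix.col_apply, Pi.add_apply, Pi.single_apply, Pi.single_apply]
  by_cases h1 : w = u
  · subst h1
    simp [HX, hs, huv]
  · simp [HX, hs, h1]

lemma HZ_mulVec_single [DecidableEq F] (K : CellComplex V E F) {e : E} {f g : F} (hfg : f ≠ g)
    (hs : ∀ h, K.sideOf e h ↔ h = f ∨ h = g) :
    K.HZ *ᵥ Pi.single e 1 = Pi.single f 1 + Pi.single g 1 :=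
  HX_mulVec_single (K := K.dual) hfg hs

end CellComplex

section OddMap

variable (m₁ m₂ : ℕ) [hm : Fact (3 ≤ m₁)]

/-! ### A cycle of length `4` that is not a boundary -/

lemma zero_lt_of_fact : 0 < m₁ := by
  have := hm.out
  omega

/-- The edge `{n, n + 1}`. -/
def shortEdge (n : ℕ) : oddMapEdges m₁ m₂ :=
  stepEdge m₁ m₂ (zero_lt_of_fact m₁) (residue m₁ m₂ n)

/-- The edge `{n, n + N}`, where `N` is half the number of vertices. -/
def longEdge (n : ℕ) : oddMapEdges m₁ m₂ :=
  stepEdge m₁ m₂ (Nat.sub_lt (zero_lt_of_fact m₁) one_pos) (residue m₁ m₂ n)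

lemma endOf_shortEdge (n : ℕ) (v : Fin (oddMapOrder m₁ m₂)) :
    (oddMap m₁ m₂).endOf v (shortEdge m₁ m₂ n) ↔
      v = residue m₁ m₂ n ∨ v = residue m₁ m₂ (n + 1) := by
  rw [shortEdge, endOf_stepEdge, residue_add, stepRes, stepLength_zero]

lemma endOf_longEdge (n : ℕ) (v : Fin (oddMapOrder m₁ m₂)) :
    (oddMap m₁ m₂).endOf v (longEdge m₁ m₂ n) ↔
      v = residue m₁ m₂ n ∨ v = residue m₁ m₂ (n + halfOrder m₁ m₂) := by
  rw [longEdge, endOf_stepEdge, residue_add, stepRes, stepLength_last]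

/-- The edge {x, x + 1} lies on the faces x and x - 1; taking x = n + 1 avoids natural subtraction.
-/
lemma sideOf_shortEdge (n : ℕ) (f : Fin (oddMapOrder m₁ m₂)) :
    (oddMap m₁ m₂).sideOf (shortEdge m₁ m₂ (n + 1)) f ↔
      f = residue m₁ m₂ (n + 1) ∨ f = residue m₁ m₂ n := by
  rw [shortEdge, sideOf_stepEdge, stepRes, stepLength_zero, mul_zero, offsetRes_zero, add_zero,
    residue_add, add_left_inj, eq_comm, eq_comm (b := f)]

lemma sideOf_longEdge (n : ℕ) (f : Fin (oddMapOrder m₁ m₂)) :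
    (oddMap m₁ m₂).sideOf (longEdge m₁ m₂ n) f ↔
      f = residue m₁ m₂ n ∨ f = residue m₁ m₂ (n + halfOrder m₁ m₂) := by
  have h := stepRes_last_add m₁ m₂
  have h' : residue m₁ m₂ (halfOrder m₁ m₂) = stepRes m₁ m₂ (m₁ - 1) := by
    rw [stepRes, stepLength_last]
  rw [longEdge, sideOf_stepEdge, offsetRes_last, residue_add, h', add_assoc, h, add_zero, or_comm,
    eq_comm]
  refine or_congr_right ⟨fun hf => ?_, fun hf => ?_⟩
  · rw [hf, add_assoc, h, add_zero]
  · rw [hf, add_assoc, h, add_zero]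

lemma shortEdge_ne {a b : ℕ} (ha : a < oddMapOrder m₁ m₂) (hb : b < oddMapOrder m₁ m₂)
    (hab : a ≠ b) : shortEdge m₁ m₂ a ≠ shortEdge m₁ m₂ b := by
  intro h
  rcases (stepPair_inj m₁ m₂ (zero_lt_of_fact m₁) (zero_lt_of_fact m₁)
    (congrArg Subtype.val h)).2 with h | ⟨h, -⟩
  · exact hab ((residue_inj m₁ m₂ ha hb).1 h)
  · have := hm.out
    omega

/-- The bound is N rather than 2N because n and n + N give the same diameter. -/
lemma longEdge_ne {a b : ℕ} (ha : a < halfOrder m₁ m₂) (hb : b < halfOrder m₁ m₂)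
    (hab : a ≠ b) : longEdge m₁ m₂ a ≠ longEdge m₁ m₂ b := by
  intro h
  have h2 := oddMapOrder_eq m₁ m₂
  have hlt : m₁ - 1 < m₁ := Nat.sub_lt (zero_lt_of_fact m₁) one_pos
  rcases (stepPair_inj m₁ m₂ hlt hlt (congrArg Subtype.val h)).2 with h | ⟨-, h⟩
  · rw [residue_inj] at h <;> omega
  · rw [stepRes, stepLength_last, ← residue_add, residue_inj] at h <;> omega

lemma shortEdge_ne_longEdge (a b : ℕ) : shortEdge m₁ m₂ a ≠ longEdge m₁ m₂ b := by
  intro h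
  have := hm.out
  have := (stepPair_inj m₁ m₂ (zero_lt_of_fact m₁) (Nat.sub_lt (zero_lt_of_fact m₁) one_pos)
    (congrArg Subtype.val h)).1
  omega

/-- The closed walk `0, 1, N + 1, N`. -/
def fourCycle : oddMapEdges m₁ m₂ → ZMod 2 :=
  Pi.single (shortEdge m₁ m₂ 0) 1 + Pi.single (shortEdge m₁ m₂ (halfOrder m₁ m₂)) 1 +
    Pi.single (longEdge m₁ m₂ 0) 1 + Pi.single (longEdge m₁ m₂ 1) 1

/-- The edges that the closed walk through the faces `1, 2, N + 2, N + 1` crosses. -/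
def fourCocycle : oddMapEdges m₁ m₂ → ZMod 2 :=
  Pi.single (shortEdge m₁ m₂ 2) 1 + Pi.single (shortEdge m₁ m₂ (halfOrder m₁ m₂ + 2)) 1 +
    Pi.single (longEdge m₁ m₂ 1) 1 + Pi.single (longEdge m₁ m₂ 2) 1

lemma residue_ne {a b : ℕ} (ha : a < oddMapOrder m₁ m₂) (hb : b < oddMapOrder m₁ m₂)
    (hab : a ≠ b) : residue m₁ m₂ a ≠ residue m₁ m₂ b :=
  (residue_inj m₁ m₂ ha hb).not.2 hab

/-- The boundary of a quadrilateral modulo 2: every corner is an end of two sides. -/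
lemma sum_pairs_eq_zero {G : Type} [AddCommGroup G] (h : ∀ x : G, x + x = 0) (a b c d : G) :
    (a + b) + (c + d) + (a + c) + (b + d) = 0 := by
  rw [show (a + b) + (c + d) + (a + c) + (b + d) = (a + a) + (b + b) + ((c + c) + (d + d)) by abel]
  simp only [h]

lemma fourCycle_mem : fourCycle m₁ m₂ ∈ (oddMap m₁ m₂).codeX := by
  have h8 := eight_le_halfOrder m₁ m₂
  have h2 := oddMapOrder_eq m₁ m₂
  change (oddMap m₁ m₂).HX *ᵥ _ = 0
  rw [fourCycle, Matrix.mulVec_add, Matrix.mulVec_add, Matrix.mulVec_add,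
    CellComplex.HX_mulVec_single _ (residue_ne m₁ m₂ (by omega) (by omega) (by omega))
      (endOf_shortEdge m₁ m₂ 0),
    CellComplex.HX_mulVec_single _ (residue_ne m₁ m₂ (by omega) (by omega) (by omega))
      (endOf_shortEdge m₁ m₂ (halfOrder m₁ m₂)),
    CellComplex.HX_mulVec_single _ (residue_ne m₁ m₂ (by omega) (by omega) (by omega))
      (endOf_longEdge m₁ m₂ 0),
    CellComplex.HX_mulVec_single _ (residue_ne m₁ m₂ (by omega) (by omega) (by omega))
      (endOf_longEdge m₁ m₂ 1), zero_add, zero_add, add_comm 1 (halfOrder m₁ m₂)]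
  exact sum_pairs_eq_zero CharTwo.add_self_eq_zero _ _ _ _

lemma fourCocycle_mem : fourCocycle m₁ m₂ ∈ (oddMap m₁ m₂).codeZ := by
  have h8 := eight_le_halfOrder m₁ m₂
  have h2 := oddMapOrder_eq m₁ m₂
  change (oddMap m₁ m₂).HZ *ᵥ _ = 0
  rw [fourCocycle, Matrix.mulVec_add, Matrix.mulVec_add, Matrix.mulVec_add,
    CellComplex.HZ_mulVec_single _ (residue_ne m₁ m₂ (by omega) (by omega) (by omega))
      (sideOf_shortEdge m₁ m₂ 1),
    CellComplex.HZ_mulVec_single _ (residue_ne m₁ m₂ (by omega) (by omega) (by omega))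
      (sideOf_shortEdge m₁ m₂ (halfOrder m₁ m₂ + 1)),
    CellComplex.HZ_mulVec_single _ (residue_ne m₁ m₂ (by omega) (by omega) (by omega))
      (sideOf_longEdge m₁ m₂ 1),
    CellComplex.HZ_mulVec_single _ (residue_ne m₁ m₂ (by omega) (by omega) (by omega))
      (sideOf_longEdge m₁ m₂ 2), add_comm 1 (halfOrder m₁ m₂), add_comm 2 (halfOrder m₁ m₂),
    add_right_comm _ (Pi.single (residue m₁ m₂ 1) 1 + _)]
  exact sum_pairs_eq_zero CharTwo.add_self_eq_zero _ _ _ _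

/-- The supports meet only in `longEdge 1`. The odd intersection shows that the cycle is not a
boundary. -/
lemma fourCycle_dotProduct_fourCocycle : fourCycle m₁ m₂ ⬝ᵥ fourCocycle m₁ m₂ ≠ 0 := by
  have h8 := eight_le_halfOrder m₁ m₂
  have h2 := oddMapOrder_eq m₁ m₂
  have h : fourCycle m₁ m₂ ⬝ᵥ fourCocycle m₁ m₂ = 1 := by
    simp only [fourCycle, fourCocycle, add_dotProduct, single_one_dotProduct, Pi.add_apply,
      Pi.single_apply]
    rw [if_neg (shortEdge_ne m₁ m₂ (by omega) (by omega) (by omega)),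
      if_neg (shortEdge_ne m₁ m₂ (by omega) (by omega) (by omega)),
      if_neg (shortEdge_ne_longEdge m₁ m₂ _ _), if_neg (shortEdge_ne_longEdge m₁ m₂ _ _),
      if_neg (shortEdge_ne m₁ m₂ (by omega) (by omega) (by omega)),
      if_neg (shortEdge_ne m₁ m₂ (by omega) (by omega) (by omega)),
      if_neg (shortEdge_ne_longEdge m₁ m₂ _ _), if_neg (shortEdge_ne_longEdge m₁ m₂ _ _),
      if_neg (shortEdge_ne_longEdge m₁ m₂ _ _).symm, if_neg (shortEdge_ne_longEdge m₁ m₂ _ _).symm,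
      if_neg (longEdge_ne m₁ m₂ (by omega) (by omega) (by omega)),
      if_neg (longEdge_ne m₁ m₂ (by omega) (by omega) (by omega)),
      if_neg (shortEdge_ne_longEdge m₁ m₂ _ _).symm, if_neg (shortEdge_ne_longEdge m₁ m₂ _ _).symm,
      if_pos trivial, if_neg (longEdge_ne m₁ m₂ (by omega) (by omega) (by omega))]
    simp
  rw [h]
  exact one_ne_zero

lemma hammingNorm_add_single {ι : Type} [Fintype ι] [DecidableEq ι] {x : ι → ZMod 2} {i : ι}
    (h : x i = 0) : hammingNorm (x + Pi.single i 1) = hammingNorm x + 1 := by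
  rw [hammingNorm, hammingNorm, ← Finset.card_insert_of_notMem (a := i) (by simpa using h)]
  congr 1
  ext j
  by_cases hj : j = i
  · subst hj
    simp [h]
  · simp [hj]

lemma hammingNorm_fourCycle : hammingNorm (fourCycle m₁ m₂) = 4 := by
  have h8 := eight_le_halfOrder m₁ m₂
  have h2 := oddMapOrder_eq m₁ m₂
  have hs : shortEdge m₁ m₂ (halfOrder m₁ m₂) ≠ shortEdge m₁ m₂ 0 :=
    shortEdge_ne m₁ m₂ (by omega) (by omega) (by omega)
  have hl : longEdge m₁ m₂ 1 ≠ longEdge m₁ m₂ 0 :=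
    longEdge_ne m₁ m₂ (by omega) (by omega) (by omega)
  have hsl := fun a b => (shortEdge_ne_longEdge m₁ m₂ a b).symm
  rw [fourCycle, hammingNorm_add_single, hammingNorm_add_single, hammingNorm_add_single,
    ← zero_add (Pi.single (shortEdge m₁ m₂ 0) 1), hammingNorm_add_single, hammingNorm_zero]
  · rfl
  · simp [hs]
  · simp [hsl]
  · simp [hsl, hl]

/-! ### Number of edges, code parameters and encoding rate. -/

lemma card_oddMapEdges :
    Fintype.card (oddMapEdges m₁ m₂) = (2 * m₁ - 1) * halfOrder m₁ m₂ := by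
  have h := (oddMap m₁ m₂).two_mul_card_edges (oddMap_isMap m₁ m₂) (oddMap_isEquivelar m₁ m₂).1
  rw [Fintype.card_fin] at h
  exact Nat.eq_of_mul_eq_mul_left two_pos
    (h.trans (by rw [oddMapOrder_eq, mul_left_comm]))

lemma oddMap_isHomologicalCode : (oddMap m₁ m₂).IsHomologicalCode
    ((2 * m₁ - 1) * halfOrder m₁ m₂) (2 + (2 * m₁ - 5) * halfOrder m₁ m₂) 4 := by
  refine (oddMap m₁ m₂).isHomologicalCode_of_isSelfDual (oddMap_isMap m₁ m₂)
    (oddMap_isSelfDual m₁ m₂) (oddMap_no_triangle m₁ m₂) (fourCycle_mem m₁ m₂)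
    (fourCocycle_mem m₁ m₂) (fourCycle_dotProduct_fourCocycle m₁ m₂)
    (hammingNorm_fourCycle m₁ m₂) (card_oddMapEdges m₁ m₂) ?_
  have hm := hm.out
  have h8 := eight_le_halfOrder m₁ m₂
  -- After splitting off 4N from n, what remains is 4N = 2 + 2 (2N - 1).
  rw [Fintype.card_fin, oddMapOrder_eq, show 2 * m₁ - 1 = 2 * m₁ - 5 + 4 by omega, add_mul]
  omega

lemma encodingRate_oddMap : encodingRate (oddMap m₁ m₂).stabilizer =
    1 - (4 * halfOrder m₁ m₂ - 2) / ((2 * m₁ - 1) * halfOrder m₁ m₂) := by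
  obtain ⟨-, ⟨-, hn, hk, -⟩, -, -⟩ := oddMap_isHomologicalCode m₁ m₂
  have hm := hm.out
  have h8 : (8 : ℝ) ≤ halfOrder m₁ m₂ := by exact_mod_cast eight_le_halfOrder m₁ m₂
  have hm' : (3 : ℝ) ≤ m₁ := by exact_mod_cast hm
  have hpos : (0 : ℝ) < (2 * m₁ - 1) * halfOrder m₁ m₂ := mul_pos (by linarith) (by linarith)
  rw [encodingRate, hn, hk]
  push_cast [Nat.cast_sub (show 1 ≤ 2 * m₁ by omega), Nat.cast_sub (show 5 ≤ 2 * m₁ by omega)]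
  rw [Real.logb_pow, Real.logb_self_eq_one (by norm_num), eq_sub_iff_add_eq, ← add_div,
    div_eq_one_iff_eq hpos.ne']
  push_cast [Nat.cast_sub (show 5 ≤ 2 * m₁ by omega)]
  ring

end OddMap

/-- The rate lies between 1 - 4 / (2 m₁ - 1) and 1 for every m₂, so growth of m₁ alone forces the
limit. -/
lemma tendsto_encodingRate_oddMap :
    Tendsto (fun m : ℕ × ℕ => encodingRate (oddMap m.1 m.2).stabilizer) atTop (𝓝 1) := by
  have hfst : Tendsto (fun m : ℕ × ℕ => (m.1 : ℝ)) atTop atTop := by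
    rw [← prod_atTop_atTop_eq]
    exact tendsto_natCast_atTop_atTop.comp tendsto_fst
  have hlow : Tendsto (fun m : ℕ × ℕ => 1 - 4 / (2 * (m.1 : ℝ) - 1)) atTop (𝓝 1) := by
    have h1 : Tendsto (fun m : ℕ × ℕ => 2 * (m.1 : ℝ) - 1) atTop atTop :=
      tendsto_atTop_add_const_right _ _ (hfst.const_mul_atTop (by norm_num))
    simpa using (h1.const_div_atTop 4).const_sub 1
  have hev : ∀ᶠ m : ℕ × ℕ in atTop, 3 ≤ m.1 := by
    filter_upwards [hfst.eventually_ge_atTop 3] with m hm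
    exact_mod_cast hm
  refine tendsto_of_tendsto_of_tendsto_of_le_of_le' hlow tendsto_const_nhds ?_ ?_
  · filter_upwards [hev] with m hm
    have : Fact (3 ≤ m.1) := ⟨hm⟩
    have h8 : (8 : ℝ) ≤ halfOrder m.1 m.2 := by exact_mod_cast eight_le_halfOrder m.1 m.2
    have hm' : (3 : ℝ) ≤ m.1 := by exact_mod_cast hm
    rw [encodingRate_oddMap]
    refine sub_le_sub_left ?_ 1
    rw [div_le_div_iff₀ (mul_pos (by linarith) (by linarith)) (by linarith)]
    nlinarith
  · filter_upwards [hev] with m hm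
    have : Fact (3 ≤ m.1) := ⟨hm⟩
    have h8 : (8 : ℝ) ≤ halfOrder m.1 m.2 := by exact_mod_cast eight_le_halfOrder m.1 m.2
    have hm' : (3 : ℝ) ≤ m.1 := by exact_mod_cast hm
    rw [encodingRate_oddMap]
    refine sub_le_self 1 (div_nonneg (by linarith) (mul_nonneg (by linarith) (by linarith)))

theorem mainTheorem1 :
    (∀ m₁ m₂ : ℕ, 3 ≤ m₁ →
      (oddMap m₁ m₂).IsMap ∧
      (oddMap m₁ m₂).IsEquivelar (2 * m₁ - 1) (2 * m₁ - 1) ∧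
      (oddMap m₁ m₂).IsSelfDual ∧
      Nat.card (Fin (oddMapOrder m₁ m₂)) = 2 * (3 ^ (m₁ - 1) + 2 * m₂ - 1) ∧
      (oddMap m₁ m₂).IsHomologicalCode
        ((2 * m₁ - 1) * (3 ^ (m₁ - 1) + 2 * m₂ - 1))
        (2 + (2 * m₁ - 5) * (3 ^ (m₁ - 1) + 2 * m₂ - 1)) 4) ∧
    Tendsto (fun m : ℕ × ℕ => encodingRate (oddMap m.1 m.2).stabilizer) atTop (𝓝 1) := by
  refine ⟨fun m₁ m₂ h => ?_, tendsto_encodingRate_oddMap⟩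
  have : Fact (3 ≤ m₁) := ⟨h⟩
  exact ⟨oddMap_isMap m₁ m₂, oddMap_isEquivelar m₁ m₂, oddMap_isSelfDual m₁ m₂, Nat.card_fin _,
    oddMap_isHomologicalCode m₁ m₂⟩
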